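/- **Model.** Let $D:\mathbb R_+\to[0,\infty]$ be continuous and strictly decreasing with $D(0)=\infty$ and $D(p)\to0$ as $p\to\infty$. Let $\pi:\mathbb R_+^2\to\mathbb R$ (profit) and $q:\mathbb R_+^2\to\mathbb R_+$ (output) be continuous and increasing functions of (productivity $\varphi$, price $p$), with $\pi$ strictly increasing in each argument whenever the other one is positive, $q(\cdot,p)$ strictly increasing for every $p>0$, and $\pi(\varphi,p)<0$ if $\varphi=0$ or $p=0$. Let $\Gamma$ be a Markov kernel on $\mathbb R_+$, $\gamma$ a Borel probability on $\mathbb R_+$, $c_e>0$, $r>0$ and $\beta=1/(1+r)$. Assume: 1. $\varphi\mapsto\Gamma(\varphi,[0,a])$ is decreasing for all $a\ge0$; for all $a>0$, $\varphi\ge0$ there is $n$ with $\Gamma^n(\varphi,[0,a))>0$; for each $p>0$ there is $\varphi$ with $\int\pi(\varphi',p)\,\Gamma(\varphi,d\varphi')\ge0$. 2. $\int q(\varphi,p)\,\gamma(d\varphi)<\infty$ for all $p$; $\gamma([0,a])>0$ for all $a>0$; $\int\pi(\varphi,p)\,\gamma(d\varphi)\ge c_e$ for some $p>0$. 3. $\sum_{t\ge1}\beta^t\int\pi(\varphi',p)\,\Gamma^t(0,d\varphi')\le0$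 for all $p\ge 0$. 4. For some $\delta\in(\beta,1)$, $\sum_{t\ge0}\delta^t\int\pi(\varphi,p)\,(\gamma\Gamma^t)(d\varphi)<\infty$ for all $p\ge0$; and if $\gamma$ does not have full support, then $\kappa(\varphi,p):=\sum_{t\ge0}\delta^t\int(\pi(\varphi',p)+b)\,\Gamma^t(\varphi,d\varphi')$, with $b:=1-\pi(0,0)$, is finite everywhere. 5. For every $u$ in $\mathscr C$, the class of continuous increasing functions on $\mathbb R_+^2$ with $\sup|u/\kappa|<\infty$, the map $(\varphi,p)\mapsto\int u(\varphi',p)\,\Gamma(\varphi,d\varphi')$ is continuous. Suppose moreover that output is a Foster–Lyapunov function: for each $p>0$, $q(\varphi,p)\to\infty$ as $\varphi\to\infty$, and there are $\lambda\in(0,1)$ and $L<\infty$ with $\int q(\varphi',p)\,\Gamma(\varphi,d\varphi')\le\lambda q(\varphi,p)+L$ for all $\varphi\ge0$. **Notation.** For a function $v$ on $\mathbb R_+^2$ put $\bar\varphi(p)=\inf\{\varphi\ge 0:\int v(\varphi',p)\,\Gamma(\varphi,d\varphi')\ge0\}\in[0,\infty]$. Let $(\varphi_t)_{t\ge1}$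 be the Markov process with $\varphi_1\sim\gamma$ and kernel $\Gamma$, and let $\tau(p)=\inf\{t\ge1:\varphi_t<\bar\varphi(p)\}$, $\ell(p)=\mathbb E\sum_{t=1}^{\tau(p)}q(\varphi_t,p)$ and $\Pi_p(\varphi,B)=\Gamma(\varphi,B)\mathbf 1\{\varphi\ge\bar\varphi(p)\}+\gamma(B)\mathbf 1\{\varphi<\bar\varphi(p)\}$. A stationary recursive equilibrium is a triple $(p,\mu,M)$ with $p>0$, $\mu$ a finite Borel measure on $\mathbb R_+$ and $M\ge0$ such that $\int v(\varphi,p)\,\gamma(d\varphi)\le c_e$ with equality if $M>0$; $\mu(B)=\int_{\{\varphi\ge\bar\varphi(p)\}}\Gamma(\varphi,B)\,\mu(d\varphi)+M\gamma(B)$ for all Borel $B$; $M=\mu\{\varphi<\bar\varphi(p)\}$; and $\int q(\varphi,p)\,\mu(d\varphi)=D(p)$. **Conclusion.** There is a unique $v\in\mathscr C$ with $v(\varphi,p)=\pi(\varphi,p)+\beta\max\{0,\int v(\varphi',p)\,\Gamma(\varphi,d\varphi')\}$. With this $v$: - $\ell(p)<\infty$ for every $p>0$. - For every $p>0$ the kernel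 $\Pi_p$ is $V$-uniformly ergodic with $V=1+q(\cdot,p)$: it has an invariant probability $\mu_p$ with $\int V\,d\mu_p<\infty$, all the integrals $\int V\,d\Pi_p^n(\varphi,\cdot)$ are finite, and there are $C$ and $\rho\in[0,1)$ with $|\int f\,d\Pi_p^n(\varphi,\cdot)-\int f\,d\mu_p|\le C\rho^nV(\varphi)$ for all $n\ge0$, all $\varphi\ge0$ and all measurable $f$ with $|f|\le V$. - There is a unique $p^*>0$ with $\int v(\varphi,p^*)\,\gamma(d\varphi)=c_e$. A stationary recursive equilibrium exists and is unique; its price is $p^*$, its mass of entrants $M^*$ is strictly positive, and its measure satisfies $\mu^*(B)=M^*\,\mathbb E\sum_{t=1}^{\tau(p^*)}\mathbf 1\{\varphi_t\in B\}$ for all Borel $B$. -/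

import Mathlib

open MeasureTheory ProbabilityTheory Filter Topology
open scoped NNReal ENNReal

noncomputable section

/-- The primitives of the entry-exit model. Productivities and prices range over `ℝ≥0`. -/
structure Industry where
  /-- demand, as a function of the output price -/
  D : ℝ≥0 → ℝ≥0∞
  /-- profit `π(φ, p)` at productivity `φ` and output price `p` -/
  profit : ℝ≥0 → ℝ≥0 → ℝ
  /-- output `q(φ, p)`, which is nonnegative -/
  q : ℝ≥0 → ℝ≥0 → ℝ≥0
  /-- the productivity kernel of incumbents -/
  Γ : Kernel ℝ≥0 ℝ≥0
  [isMarkovKernel : IsMarkovKernel Γ]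
  /-- the productivity distribution of entrants -/
  γ : Measure ℝ≥0
  [isProbabilityMeasure : IsProbabilityMeasure γ]
  /-- the entry cost -/
  ce : ℝ
  /-- the interest rate -/
  r : ℝ

namespace Industry

instance (E : Industry) : IsMarkovKernel E.Γ := E.isMarkovKernel

instance (E : Industry) : IsProbabilityMeasure E.γ := E.isProbabilityMeasure

/-- The discount factor `β = 1 / (1 + r)`. -/
def β (E : Industry) : ℝ := 1 / (1 + E.r)

/-! ### The firm decision problem -/

/-- A constant `b` with `π + b ≥ 1`; as `π` is increasing, this is the smallest one. Another
admissible constant leads to an equivalent weighted norm below. -/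
def shift (E : Industry) : ℝ := 1 - E.profit 0 0

/-- The weight `κ(φ, p) = ∑ₜ δ ^ t 𝔼_φ (π(φₜ, p) + b)`, a sum of nonnegative terms. -/
def kappa (E : Industry) (δ : ℝ) (φ p : ℝ≥0) : ℝ≥0∞ :=
  ∑' t : ℕ, ENNReal.ofReal (δ ^ t) *
    ∫⁻ x, ENNReal.ofReal (E.profit x p + E.shift) ∂((E.Γ ^ t) φ)

/-- The class `𝒞` of continuous, increasing and `κ`-bounded functions on `ℝ₊²`. -/
structure MemC (E : Industry) (δ : ℝ) (u : ℝ≥0 → ℝ≥0 → ℝ) : Prop where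
  continuous : Continuous (Function.uncurry u)
  monotone : Monotone (Function.uncurry u)
  bounded : ∃ C : ℝ, ∀ φ p, |u φ p| ≤ C * (E.kappa δ φ p).toReal

/-- The Bellman operator. -/
def bellman (E : Industry) (v : ℝ≥0 → ℝ≥0 → ℝ) (φ p : ℝ≥0) : ℝ :=
  E.profit φ p + E.β * max 0 (∫ x, v x p ∂(E.Γ φ))

/-- `v` is a value function: a fixed point of the Bellman operator in the class `𝒞`. -/
def IsValueFunction (E : Industry) (δ : ℝ) (v : ℝ≥0 → ℝ≥0 → ℝ) : Prop :=
  E.MemC δ v ∧ E.bellman v = v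

/-! ### Standing conditions -/

/-- The standing conditions on the primitives, with the constant `δ` of the growth condition. -/
structure Conditions (E : Industry) (δ : ℝ) : Prop where
  -- demand
  D_continuous : Continuous E.D
  D_strictAnti : StrictAnti E.D
  D_zero : E.D 0 = ∞
  D_tendsto : Tendsto E.D atTop (𝓝 0)
  -- constants
  r_pos : 0 < E.r
  ce_pos : 0 < E.ce
  -- profit and output: continuous and increasing; strictness is asked for away from the boundary
  -- of the quadrant only (and, for output, in productivity only)
  profit_continuous : Continuous (Function.uncurry E.profit)
  profit_monotone : Monotone (Function.uncurry E.profit)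
  profit_strictMono_left : ∀ p, 0 < p → StrictMono fun φ => E.profit φ p
  profit_strictMono_right : ∀ φ, 0 < φ → StrictMono fun p => E.profit φ p
  profit_neg : ∀ φ p, φ = 0 ∨ p = 0 → E.profit φ p < 0
  q_continuous : Continuous (Function.uncurry E.q)
  q_monotone : Monotone (Function.uncurry E.q)
  q_strictMono_left : ∀ p, 0 < p → StrictMono fun φ => E.q φ p
  -- the productivity kernel is monotone, satisfies the recurrence condition, and lets some
  -- incumbents stay
  Γ_monotone : ∀ a : ℝ≥0, Antitone fun φ => E.Γ φ (Set.Iic a)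
  Γ_recurrent : ∀ a : ℝ≥0, 0 < a → ∀ φ, ∃ n : ℕ, 0 < (E.Γ ^ n) φ (Set.Iio a)
  exists_stay : ∀ p, 0 < p → ∃ φ, 0 ≤ ∫ x, E.profit x p ∂(E.Γ φ)
  -- entrants
  lintegral_q_lt_top : ∀ p, ∫⁻ x, E.q x p ∂E.γ < ∞
  γ_pos : ∀ a : ℝ≥0, 0 < a → 0 < E.γ (Set.Iic a)
  exists_entry : ∃ p, 0 < p ∧ E.ce ≤ ∫ x, E.profit x p ∂E.γ
  -- at zero productivity, expected discounted profits from the next period on are nonpositive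
  profit_zero : ∀ p, ∑' t : ℕ, E.β ^ (t + 1) * ∫ x, E.profit x p ∂((E.Γ ^ (t + 1)) 0) ≤ 0
  -- growth condition; the law of an entrant's productivity after `t` transitions is `γ Γ ^ t`
  δ_mem : δ ∈ Set.Ioo E.β 1
  integrable_profit : ∀ p, ∀ t : ℕ, Integrable (fun x => E.profit x p) (E.γ.bind ⇑(E.Γ ^ t))
  summable_profit : ∀ p,
    Summable fun t : ℕ => δ ^ t * ∫ x, E.profit x p ∂(E.γ.bind ⇑(E.Γ ^ t))
  -- if `γ` does not have full support, then `κ` is required to be finite everywhere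
  kappa_finite : ¬ E.γ.IsOpenPosMeasure → ∀ φ p, E.kappa δ φ p < ∞
  -- continuity of the transition operator on `𝒞`
  continuous_integral : ∀ u, E.MemC δ u →
    Continuous fun x : ℝ≥0 × ℝ≥0 => ∫ y, u y x.2 ∂(E.Γ x.1)

/-- The Foster–Lyapunov condition with output as the Lyapunov function, at every positive price:
output becomes large as the state diverges, and it has geometric drift. -/
def OutputDrift (E : Industry) : Prop :=
  ∀ p, 0 < p → Tendsto (fun φ => E.q φ p) atTop atTop ∧
    ∃ lam L : ℝ≥0, 0 < lam ∧ lam < 1 ∧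
      ∀ φ, ∫⁻ x, E.q x p ∂(E.Γ φ) ≤ lam * E.q φ p + L

/-! ### Exit, lifetime output and equilibrium -/

/-- The exit threshold at price `p`, given the value function `v`; it is `∞` if no productivity
makes staying profitable. -/
def exitThreshold (E : Industry) (v : ℝ≥0 → ℝ≥0 → ℝ) (p : ℝ≥0) : ℝ≥0∞ :=
  sInf ((fun φ : ℝ≥0 => (φ : ℝ≥0∞)) '' {φ | 0 ≤ ∫ x, v x p ∂(E.Γ φ)})

/-- The law of the productivity path `(φ₁, φ₂, …)` of a firm: the Markov process with initial
distribution `γ` and transition kernel `Γ`. The coordinate with index `n` is `φₙ₊₁`. -/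
def pathLaw (E : Industry) : Measure (ℕ → ℝ≥0) :=
  Kernel.trajMeasure (X := fun _ => ℝ≥0) E.γ fun n =>
    E.Γ.comap (fun x : (i : Finset.Iic n) → ℝ≥0 => x ⟨n, Finset.mem_Iic.2 le_rfl⟩)
      (measurable_pi_apply _)

/-- The productivity `φₜ` along a path, for `t ≥ 1`. -/
def productivity (ω : ℕ → ℝ≥0) (t : ℕ) : ℝ≥0 := ω (t - 1)

/-- The lifespan `τ(p) = inf {t ≥ 1 | φₜ < exit threshold}` of a firm. -/
def lifespan (E : Industry) (v : ℝ≥0 → ℝ≥0 → ℝ) (p : ℝ≥0) (ω : ℕ → ℝ≥0) : ℕ∞ :=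
  ⨅ t ∈ {t : ℕ | 1 ≤ t ∧ (productivity ω t : ℝ≥0∞) < E.exitThreshold v p}, (t : ℕ∞)

open Classical in
/-- The expected lifetime sum `𝔼 ∑_{t = 1}^{τ(p)} f(φₜ)`. -/
def lifetimeSum (E : Industry) (v : ℝ≥0 → ℝ≥0 → ℝ) (p : ℝ≥0) (f : ℝ≥0 → ℝ≥0∞) : ℝ≥0∞ :=
  ∫⁻ ω, ∑' t : ℕ, (if 1 ≤ t ∧ (t : ℕ∞) ≤ E.lifespan v p ω then f (productivity ω t) else 0)
    ∂E.pathLaw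

/-- Expected lifetime output `ℓ(p)`. -/
def lifetimeOutput (E : Industry) (v : ℝ≥0 → ℝ≥0 → ℝ) (p : ℝ≥0) : ℝ≥0∞ :=
  E.lifetimeSum v p fun φ => E.q φ p

/-- The set of productivities at which incumbents stay. -/
def staySet (E : Industry) (v : ℝ≥0 → ℝ≥0 → ℝ) (p : ℝ≥0) : Set ℝ≥0 :=
  {φ | E.exitThreshold v p ≤ (φ : ℝ≥0∞)}

theorem measurableSet_staySet (E : Industry) (v : ℝ≥0 → ℝ≥0 → ℝ) (p : ℝ≥0) :
    MeasurableSet (E.staySet v p) :=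
  measurableSet_le measurable_const measurable_coe_nnreal_ennreal

open Classical in
/-- The endogenous kernel `Π_p`: incumbents that stay move according to `Γ`, the others are
replaced by entrants drawn from `γ`. -/
def endoKernel (E : Industry) (v : ℝ≥0 → ℝ≥0 → ℝ) (p : ℝ≥0) : Kernel ℝ≥0 ℝ≥0 :=
  Kernel.piecewise (E.measurableSet_staySet v p) E.Γ (Kernel.const _ E.γ)

/-- `(p, μ, M)` is a stationary recursive equilibrium, given the value function `v`. -/
structure IsEquilibrium (E : Industry) (v : ℝ≥0 → ℝ≥0 → ℝ)
    (p : ℝ≥0) (μ : Measure ℝ≥0) (M : ℝ≥0) : Prop where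
  price_pos : 0 < p
  finite : IsFiniteMeasure μ
  entry : ∫ x, v x p ∂E.γ ≤ E.ce
  entry_eq : 0 < M → ∫ x, v x p ∂E.γ = E.ce
  invariant : ∀ B, MeasurableSet B →
    μ B = (∫⁻ φ in E.staySet v p, E.Γ φ B ∂μ) + M * E.γ B
  balanced : (M : ℝ≥0∞) = μ {φ | (φ : ℝ≥0∞) < E.exitThreshold v p}
  market : ∫⁻ φ, E.q φ p ∂μ = E.D p

end Industry

/-- `P` is `V`-uniformly ergodic: it has an invariant probability measure `μ` with `∫ V dμ < ∞`,
and `Pⁿ` converges to `μ` at a geometric rate in the operator norm given by the `V`-norm, that is,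
`|∫ f dPⁿ(φ, ·) - ∫ f dμ| ≤ C ρⁿ V(φ)` for all states `φ` and all measurable `f` with `|f| ≤ V`. -/
def IsVUniformlyErgodic (P : Kernel ℝ≥0 ℝ≥0) (V : ℝ≥0 → ℝ≥0) : Prop :=
  Measurable V ∧ (∀ φ, 1 ≤ V φ) ∧
  ∃ μ : Measure ℝ≥0, IsProbabilityMeasure μ ∧ P.Invariant μ ∧ ∫⁻ x, V x ∂μ < ∞ ∧
    (∀ (n : ℕ) (φ : ℝ≥0), ∫⁻ x, V x ∂((P ^ n) φ) < ∞) ∧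
    ∃ C ρ : ℝ, 0 ≤ ρ ∧ ρ < 1 ∧ ∀ (n : ℕ) (φ : ℝ≥0) (f : ℝ≥0 → ℝ), Measurable f →
      (∀ x, |f x| ≤ V x) → |∫ x, f x ∂((P ^ n) φ) - ∫ x, f x ∂μ| ≤ C * ρ ^ n * V φ

end

/-! The proof has three ingredients.

*The firm's problem.* The weight `κ` satisfies `δ ∫ κ dΓ ≤ κ`, so the Bellman operator contracts
`κ`-weighted distances by `β / δ < 1`, and its iterates converge locally uniformly to the unique
fixed point `v` (`exists_isValueFunction`, `isValueFunction_unique`). The value of entry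
`∫ v(·, p) dγ` is continuous and strictly increasing in `p`, nonpositive at `p = 0` and at least
`c_e` somewhere, which gives the price `p*`. The exit threshold is positive
(`integral_Γ_zero_neg`): otherwise no firm would ever exit, and the continuation value at zero
productivity would be the sum of discounted profits, which is strictly negative because the
inequality assumed for it holds at higher prices, too.

*Lifetimes.* By the Markov property, expected lifetime sums are integrals with respect to the
occupation measure `∑ₙ γ Kⁿ`, where `K` is the kernel `Γ` killed below the threshold
(`lifetimeSum_eq_tsum`). By stochastic monotonicity and recurrence, a firm exits within a fixed
number of periods with a probability that is bounded below on each sublevel set of output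
(`exists_hitting_bound`). Together with geometric drift this makes an iterate of `K` a strict
contraction of `s + q` for large `s` (`exists_killed_contraction`), and a comparison argument bounds
`∑ₙ Kⁿ (1 + q)` by a multiple of `1 + q`. So lifetime output is finite, and the normalized
occupation measure is invariant for `Π_p` (`invariant_occupation`). A measure satisfying the flow
equation of an equilibrium is `M` times the occupation measure (`eq_smul_occupation`), and market
clearing then determines `M`.

*Ergodicity.* The process `Π_p` inherits the drift condition. Once in the exit region it stays there
for as long as successive entrants start there, which happens with positive probability; hence on
each sublevel set of output one fixed iterate of `Π_p` is minorized by a multiple of `γ`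
(`pow_endoKernel_compl_ge`). Geometric convergence follows from Harris' theorem
(`harris_geometric`), proved by contraction of oscillations relative to the weight
`2 + b (q(x) + q(y))`.
-/


/-! ### Iterates of kernels -/

section Iterates

variable {α : Type*} {mα : MeasurableSpace α}

theorem kernel_pow_zero (κ : Kernel α α) (x : α) : (κ ^ 0) x = Measure.dirac x := by
  rw [pow_zero]; exact Kernel.id_apply x

theorem lintegral_pow_zero (κ : Kernel α α) (x : α) {f : α → ℝ≥0∞} (hf : Measurable f) :
    ∫⁻ y, f y ∂((κ ^ 0) x) = f x := by
  rw [kernel_pow_zero, lintegral_dirac' _ hf]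

theorem lintegral_pow_add (κ : Kernel α α) (m n : ℕ) (x : α) {f : α → ℝ≥0∞}
    (hf : Measurable f) :
    ∫⁻ y, f y ∂((κ ^ (m + n)) x) = ∫⁻ y, ∫⁻ z, f z ∂((κ ^ m) y) ∂((κ ^ n) x) := by
  rw [Kernel.pow_add, Kernel.lintegral_comp _ _ _ hf]

theorem lintegral_pow_succ (κ : Kernel α α) (n : ℕ) (x : α) {f : α → ℝ≥0∞}
    (hf : Measurable f) :
    ∫⁻ y, f y ∂((κ ^ (n + 1)) x) = ∫⁻ y, ∫⁻ z, f z ∂((κ ^ n) y) ∂(κ x) := by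
  rw [lintegral_pow_add κ n 1 x hf, pow_one]

theorem lintegral_pow_succ' (κ : Kernel α α) (n : ℕ) (x : α) {f : α → ℝ≥0∞}
    (hf : Measurable f) :
    ∫⁻ y, f y ∂((κ ^ (n + 1)) x) = ∫⁻ y, ∫⁻ z, f z ∂(κ y) ∂((κ ^ n) x) := by
  rw [add_comm, lintegral_pow_add κ 1 n x hf, pow_one]

theorem integral_pow_add (κ : Kernel α α) (m n : ℕ) (x : α) {f : α → ℝ}
    (hf : Integrable f ((κ ^ (m + n)) x)) :
    ∫ y, f y ∂((κ ^ (m + n)) x) = ∫ y, ∫ z, f z ∂((κ ^ m) y) ∂((κ ^ n) x) := by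
  rw [Kernel.pow_add] at hf ⊢
  exact Kernel.integral_comp hf

instance isMarkovKernel_pow (κ : Kernel α α) [IsMarkovKernel κ] (n : ℕ) :
    IsMarkovKernel (κ ^ n) := by
  induction n with
  | zero => rw [pow_zero]; exact inferInstanceAs (IsMarkovKernel Kernel.id)
  | succ n ih => rw [pow_succ]; exact inferInstanceAs (IsMarkovKernel ((κ ^ n) ∘ₖ κ))

/-- Iterating a geometric drift condition gives a bound on the expectation of the Lyapunov
function that is uniform in time up to the geometrically discounted initial value. -/
theorem lintegral_pow_le_of_drift (κ : Kernel α α) [IsMarkovKernel κ] {W : α → ℝ≥0}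
    (hW : Measurable W) {lam L : ℝ≥0} (hlam : lam < 1)
    (hdrift : ∀ x, ∫⁻ y, W y ∂(κ x) ≤ lam * W x + L) (n : ℕ) (x : α) :
    ∫⁻ y, W y ∂((κ ^ n) x) ≤ (lam ^ n * W x + L / (1 - lam) : ℝ≥0) := by
  have hW' : Measurable fun y => (W y : ℝ≥0∞) := hW.coe_nnreal_ennreal
  induction n with
  | zero => rw [lintegral_pow_zero _ _ hW']; simp
  | succ n ih =>
    rw [lintegral_pow_succ' _ _ _ hW']
    have hL : lam * (L / (1 - lam)) + L = L / (1 - lam) := by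
      have h1 : (1 - lam) ≠ 0 := (tsub_pos_of_lt hlam).ne'
      have h2 : lam + (1 - lam) = 1 := add_tsub_cancel_of_le hlam.le
      calc lam * (L / (1 - lam)) + L
          = lam * (L / (1 - lam)) + (1 - lam) * (L / (1 - lam)) := by
            rw [mul_div_cancel₀ _ h1]
        _ = L / (1 - lam) := by rw [← add_mul, h2, one_mul]
    calc ∫⁻ y, ∫⁻ z, W z ∂(κ y) ∂((κ ^ n) x)
        ≤ ∫⁻ y, (lam * W y + L) ∂((κ ^ n) x) := lintegral_mono hdrift
      _ = lam * ∫⁻ y, W y ∂((κ ^ n) x) + L := by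
        rw [lintegral_add_right _ measurable_const, lintegral_const_mul _ hW']; simp
      _ ≤ lam * (lam ^ n * W x + L / (1 - lam) : ℝ≥0) + L := by gcongr
      _ = (lam ^ (n + 1) * W x + L / (1 - lam) : ℝ≥0) := by
        conv_rhs => rw [← hL]
        push_cast
        ring

end Iterates

/-! ### Stochastically monotone kernels -/

section StochasticMonotonicity

theorem measure_Iio_antitone {κ : ℝ≥0 → Measure ℝ≥0}
    (h : ∀ a, Antitone fun x => κ x (Set.Iic a)) (a : ℝ≥0) :
    Antitone fun x => κ x (Set.Iio a) := by
  intro x y hxy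
  rcases eq_or_ne a 0 with rfl | ha
  · simp
  obtain ⟨u, hu, hlt, hlim⟩ := exists_seq_strictMono_tendsto' (pos_iff_ne_zero.2 ha)
  have hU : Set.Iio a = ⋃ n, Set.Iic (u n) := by
    ext z
    simp only [Set.mem_Iio, Set.mem_iUnion, Set.mem_Iic]
    constructor
    · intro hz
      obtain ⟨n, hn⟩ := (hlim.eventually (lt_mem_nhds hz)).exists
      exact ⟨n, hn.le⟩
    · rintro ⟨n, hn⟩
      exact hn.trans_lt (hlt n).2
  have hm : Monotone fun n => Set.Iic (u n) := fun i j hij => Set.Iic_subset_Iic.2 (hu.monotone hij)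
  simp only [hU]
  exact le_of_tendsto_of_tendsto' (tendsto_measure_iUnion_atTop hm)
    (tendsto_measure_iUnion_atTop hm) fun n => h (u n) hxy

/-- A family of distributions whose distribution functions decrease in `x` increases in the sense
of first-order stochastic dominance. -/
theorem measure_isUpperSet_mono {κ : ℝ≥0 → Measure ℝ≥0} [∀ x, IsProbabilityMeasure (κ x)]
    (h : ∀ a, Antitone fun x => κ x (Set.Iic a)) {s : Set ℝ≥0} (hs : IsUpperSet s) :
    Monotone fun x => κ x s := by
  have key : ∀ t : Set ℝ≥0, MeasurableSet t → (Antitone fun x => κ x t) →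
      Monotone fun x => κ x tᶜ := by
    intro t ht hanti x y hxy
    simp only [prob_compl_eq_one_sub ht]
    exact tsub_le_tsub_left (hanti hxy) 1
  rcases s.eq_empty_or_nonempty with rfl | hne
  · intro x y _; simp
  by_cases hmem : sInf s ∈ s
  · have : s = (Set.Iio (sInf s))ᶜ := by
      ext z
      simp only [Set.mem_compl_iff, Set.mem_Iio, not_lt]
      exact ⟨fun hz => csInf_le' hz, fun hz => hs hz hmem⟩
    rw [this]
    exact key _ measurableSet_Iio (measure_Iio_antitone h _)
  · have : s = (Set.Iic (sInf s))ᶜ := by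
      ext z
      simp only [Set.mem_compl_iff, Set.mem_Iic, not_le]
      constructor
      · intro hz
        exact lt_of_le_of_ne (csInf_le' hz) fun h' => hmem (h' ▸ hz)
      · intro hz
        obtain ⟨w, hw, hwz⟩ := (csInf_lt_iff (OrderBot.bddBelow s) hne).1 hz
        exact hs hwz.le hw
    rw [this]
    exact key _ measurableSet_Iic (h _)

theorem lintegral_mono_of_stochMono {κ : ℝ≥0 → Measure ℝ≥0} [∀ x, IsProbabilityMeasure (κ x)]
    (h : ∀ a, Antitone fun x => κ x (Set.Iic a)) {f : ℝ≥0 → ℝ≥0∞} (hf : Monotone f) :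
    Monotone fun x => ∫⁻ y, f y ∂(κ x) := by
  -- the layer cake formula is available for real functions, hence the truncation at height `n`
  have htrunc : ∀ n : ℕ, Monotone fun x => ∫⁻ y, min (f y) n ∂(κ x) := by
    intro n x y hxy
    have hmono : Monotone fun z => (min (f z) n).toReal := fun a b hab =>
      ENNReal.toReal_mono (by simp) (min_le_min_right _ (hf hab))
    have hEq : ∀ x, ∫⁻ y, min (f y) n ∂(κ x) =
        ∫⁻ t in Set.Ioi (0 : ℝ), κ x {z | t < (min (f z) n).toReal} := by
      intro x
      rw [← lintegral_eq_lintegral_meas_lt (κ x)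
        (Eventually.of_forall fun z => ENNReal.toReal_nonneg) hmono.measurable.aemeasurable]
      refine lintegral_congr fun z => ?_
      rw [ENNReal.ofReal_toReal (by simp)]
    simp only [hEq]
    refine lintegral_mono fun t => ?_
    exact measure_isUpperSet_mono h (fun a b hab (ha : t < _) => ha.trans_le (hmono hab)) hxy
  have hsup : ∀ x, ∫⁻ y, f y ∂(κ x) = ⨆ n : ℕ, ∫⁻ y, min (f y) n ∂(κ x) := by
    intro x
    rw [← lintegral_iSup (fun n => hf.measurable.min measurable_const)
      (fun i j hij z => min_le_min_left _ (by exact_mod_cast hij))]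
    refine lintegral_congr fun z => ?_
    rw [← inf_iSup_eq, ENNReal.iSup_natCast]
    simp
  intro x y hxy
  simp only [hsup]
  exact iSup_mono fun n => htrunc n hxy

theorem lintegral_pow_mono_of_stochMono {κ : Kernel ℝ≥0 ℝ≥0} [IsMarkovKernel κ]
    (h : ∀ a, Antitone fun x => κ x (Set.Iic a)) {f : ℝ≥0 → ℝ≥0∞} (hf : Monotone f) (n : ℕ) :
    Monotone fun x => ∫⁻ y, f y ∂((κ ^ n) x) := by
  induction n with
  | zero => simpa only [lintegral_pow_zero _ _ hf.measurable] using hf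
  | succ n ih =>
    simp only [lintegral_pow_succ _ _ _ hf.measurable]
    exact lintegral_mono_of_stochMono h ih

theorem pow_Iio_antitone_of_stochMono {κ : Kernel ℝ≥0 ℝ≥0} [IsMarkovKernel κ]
    (h : ∀ a, Antitone fun x => κ x (Set.Iic a)) (n : ℕ) (a : ℝ≥0) :
    Antitone fun x => (κ ^ n) x (Set.Iio a) := by
  have h1 : Monotone ((Set.Ici a).indicator (1 : ℝ≥0 → ℝ≥0∞)) := by
    intro x y hxy
    by_cases hx : a ≤ x
    · simp [Set.indicator, hx, hx.trans hxy]
    · simp [Set.indicator, hx]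
  have h2 := lintegral_pow_mono_of_stochMono h h1 n
  simp only [lintegral_indicator_one measurableSet_Ici] at h2
  intro x y hxy
  have h3 : Set.Iio a = (Set.Ici a)ᶜ := Set.compl_Ici.symm
  simp only [h3, prob_compl_eq_one_sub measurableSet_Ici]
  exact tsub_le_tsub_left (h2 hxy) 1

theorem integral_mono_of_stochMono {κ : ℝ≥0 → Measure ℝ≥0} [∀ x, IsProbabilityMeasure (κ x)]
    (h : ∀ a, Antitone fun x => κ x (Set.Iic a)) {f : ℝ≥0 → ℝ} (hf : Monotone f)
    (hint : ∀ x, Integrable f (κ x)) : Monotone fun x => ∫ y, f y ∂(κ x) := by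
  have hnn : ∀ y, 0 ≤ f y - f 0 := fun y => sub_nonneg.2 (hf zero_le)
  have hg : Monotone fun y => ENNReal.ofReal (f y - f 0) := fun a b hab =>
    ENNReal.ofReal_le_ofReal (sub_le_sub_right (hf hab) _)
  have hEq : ∀ x, ∫ y, f y ∂(κ x) = (∫⁻ y, ENNReal.ofReal (f y - f 0) ∂(κ x)).toReal + f 0 := by
    intro x
    rw [← integral_eq_lintegral_of_nonneg_ae (Eventually.of_forall hnn)
      (hf.measurable.sub_const _).aestronglyMeasurable, integral_sub (hint x) (integrable_const _)]
    simp
  intro x y hxy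
  simp only [hEq]
  exact add_le_add_left (ENNReal.toReal_mono
    ((hint y).sub (integrable_const _)).lintegral_lt_top.ne
    (lintegral_mono_of_stochMono h hg hxy)) _

end StochasticMonotonicity

/-! ### Harris' theorem -/

section Harris

variable {α : Type*} {mα : MeasurableSpace α}

theorem integrable_coe_of_lintegral_le {μ : Measure α} {W : α → ℝ≥0} (hW : Measurable W)
    {a : ℝ≥0} (h : ∫⁻ y, W y ∂μ ≤ a) :
    Integrable (fun y => (W y : ℝ)) μ ∧ ∫ y, (W y : ℝ) ∂μ ≤ a := by
  have hint : Integrable (fun y => (W y : ℝ)) μ := by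
    refine ⟨hW.coe_nnreal_real.aestronglyMeasurable, ?_⟩
    rw [hasFiniteIntegral_iff_enorm]
    refine lt_of_le_of_lt (le_of_eq_of_le ?_ h) ENNReal.coe_lt_top
    simp
  refine ⟨hint, ?_⟩
  rw [integral_eq_lintegral_of_nonneg_ae (f := fun y => (W y : ℝ))
    (Eventually.of_forall fun y => NNReal.coe_nonneg _)
    hW.coe_nnreal_real.aestronglyMeasurable]
  refine ENNReal.toReal_le_of_le_ofReal a.2 ?_
  simpa using h

theorem integral_bind_kernel {μ : Measure α} {κ : Kernel α α} {f : α → ℝ}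
    (hf : Integrable f (μ.bind κ)) : ∫ y, f y ∂(μ.bind κ) = ∫ x, ∫ y, f y ∂(κ x) ∂μ := by
  rw [Measure.comp_eq_comp_const_apply] at hf ⊢
  rw [Kernel.integral_comp hf, Kernel.const_apply]

/-- `c` bounds the oscillation of `g` relative to the weight `2 + b (W x + W y)`. -/
def OscLe (W : α → ℝ≥0) (b : ℝ) (g : α → ℝ) (c : ℝ) : Prop :=
  ∀ x y, g x - g y ≤ c * (2 + b * (W x + W y))

/-- A bound on the weighted oscillation is a bound on the weighted norm after subtracting a
constant. -/
theorem OscLe.exists_center {W : α → ℝ≥0} {b : ℝ} {g : α → ℝ} {c : ℝ} [Nonempty α]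
    (h : OscLe W b g c) : ∃ a : ℝ, ∀ x, |g x - a| ≤ c * (1 + b * W x) := by
  have hbd : ∀ y x, g x - c * (1 + b * W x) ≤ g y + c * (1 + b * W y) := fun y x => by
    have := h x y; linarith
  refine ⟨⨆ x, (g x - c * (1 + b * W x)), fun x => abs_le.2 ⟨?_, ?_⟩⟩
  · have := ciSup_le (hbd x); linarith
  · have := le_ciSup (f := fun x => g x - c * (1 + b * W x))
      ⟨_, by rintro _ ⟨y, rfl⟩; exact hbd x y⟩ x
    linarith

theorem OscLe.integrable {W : α → ℝ≥0} {b : ℝ} {g : α → ℝ} {c : ℝ} [Nonempty α]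
    (h : OscLe W b g c) (hg : Measurable g) {μ : Measure α} [IsFiniteMeasure μ]
    (hμ : Integrable (fun y => (W y : ℝ)) μ) : Integrable g μ := by
  obtain ⟨a, ha⟩ := h.exists_center
  have h1 : Integrable (fun y => c * (1 + b * W y)) μ :=
    ((integrable_const 1).add (hμ.const_mul b)).const_mul c
  have h2 : Integrable (fun y => g y - a) μ :=
    h1.mono' (hg.sub_const a).aestronglyMeasurable (Eventually.of_forall ha)
  exact (h2.add (integrable_const a)).congr (Eventually.of_forall fun y => by simp)

/-- Two measures with a common component `ε ν`: integrals of `h` with `|h| ≤ T` differ by at most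
the sum of the integrals of `T`, reduced by what the common component contributes. -/
theorem integral_sub_le_of_minorization {μ₁ μ₂ ν : Measure α} [IsFiniteMeasure ν] {h T : α → ℝ}
    (h1 : ν ≤ μ₁) (h2 : ν ≤ μ₂) (hh1 : Integrable h μ₁) (hh2 : Integrable h μ₂)
    (hT1 : Integrable T μ₁) (hT2 : Integrable T μ₂) (hle : ∀ x, |h x| ≤ T x) :
    ∫ x, h x ∂μ₁ - ∫ x, h x ∂μ₂ ≤ ∫ x, T x ∂μ₁ + ∫ x, T x ∂μ₂ - 2 * ∫ x, T x ∂ν := by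
  have hhν := hh1.mono_measure h1
  have hTν := hT1.mono_measure h1
  have e1 := integral_mono_measure (f := fun x => T x - h x) h1
    (Eventually.of_forall fun x => sub_nonneg.2 (abs_le.1 (hle x)).2) (hT1.sub hh1)
  have e2 := integral_mono_measure (f := fun x => T x + h x) h2
    (Eventually.of_forall fun x => by have := (abs_le.1 (hle x)).1; simp; linarith) (hT2.add hh2)
  rw [integral_sub hTν hhν, integral_sub hT1 hh1] at e1
  rw [integral_add hTν hhν, integral_add hT2 hh2] at e2
  linarith

/-- One step of Harris' theorem: under geometric drift and a minorization on a large enough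
sublevel set of the Lyapunov function `W`, the kernel contracts weighted oscillations. -/
theorem exists_oscLe_contraction [Nonempty α] (Q : Kernel α α) [IsMarkovKernel Q] {W : α → ℝ≥0}
    {lam L : ℝ} (hlam : lam < 1) (hL : 0 ≤ L)
    (hint : ∀ x, Integrable (fun y => (W y : ℝ)) (Q x))
    (hdrift : ∀ x, ∫ y, (W y : ℝ) ∂(Q x) ≤ lam * W x + L)
    {ε : ℝ} (hε : 0 < ε) (ν : Measure α) [IsFiniteMeasure ν] (hν : ε ≤ ν.real Set.univ)
    (hminor : ∀ x, (W x : ℝ) ≤ 4 * (L + 1) / (1 - lam) → ν ≤ Q x) :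
    ∃ b a : ℝ, 0 < b ∧ b ≤ 1 ∧ 0 < a ∧ a < 1 ∧ ∀ g : α → ℝ, Measurable g → ∀ c, 0 ≤ c →
      OscLe W b g c → OscLe W b (fun x => ∫ y, g y ∂(Q x)) (a * c) := by
  -- `b` is so small that drift costs less than the minorization gains on the sublevel set; `1 - b`
  -- and `(1 + lam) / 2` are admissible rates off it, `1 - ε' / 2` and `(1 + lam) / 2` on it
  obtain ⟨ε', hε', hε1, hεε'⟩ : ∃ ε' : ℝ, 0 < ε' ∧ ε' ≤ 1 ∧ ε' ≤ ε :=
    ⟨min ε 1, lt_min hε one_pos, min_le_right _ _, min_le_left _ _⟩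
  set b : ℝ := ε' / (2 * (L + 1)) with hb
  have hb0 : 0 < b := by positivity
  have hbL : 2 * b * (L + 1) = ε' := by rw [hb]; field_simp
  have hb1 : b ≤ 1 := by nlinarith
  set a : ℝ := max (max (1 - ε' / 2) ((1 + lam) / 2)) (1 - b) with ha
  have ha1 : 1 - ε' / 2 ≤ a := (le_max_left _ _).trans (le_max_left _ _)
  have ha2 : (1 + lam) / 2 ≤ a := (le_max_right _ _).trans (le_max_left _ _)
  have ha3 : 1 - b ≤ a := le_max_right _ _
  refine ⟨b, a, hb0, hb1, by linarith,
    max_lt (max_lt (by linarith) (by linarith)) (by linarith), ?_⟩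
  intro g hg c hc hosc x y
  obtain ⟨a₀, hcen⟩ := hosc.exists_center
  set T : α → ℝ := fun z => c * (1 + b * W z) with hT
  have hTint : ∀ z, Integrable T (Q z) := fun z =>
    ((integrable_const 1).add ((hint z).const_mul b)).const_mul c
  have hTval : ∀ z, ∫ w, T w ∂(Q z) ≤ c * (1 + b * (lam * W z + L)) := by
    intro z
    have : ∫ w, T w ∂(Q z) = c * (1 + b * ∫ w, (W w : ℝ) ∂(Q z)) := by
      simp only [hT]
      rw [integral_const_mul, integral_add (integrable_const 1) ((hint z).const_mul b),
        integral_const_mul]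
      simp
    rw [this]
    have := hdrift z
    gcongr
  have hgint : ∀ z, Integrable g (Q z) := fun z => hosc.integrable hg (hint z)
  have hh : ∀ z, Integrable (fun w => g w - a₀) (Q z) := fun z =>
    (hgint z).sub (integrable_const a₀)
  have hhval : ∀ z, ∫ w, (g w - a₀) ∂(Q z) = ∫ w, g w ∂(Q z) - a₀ := by
    intro z
    rw [integral_sub (hgint z) (integrable_const a₀)]; simp
  set s : ℝ := W x + W y with hs
  have hs0 : 0 ≤ s := add_nonneg (W x).coe_nonneg (W y).coe_nonneg
  -- reduction to a bound on the integrals of the centred function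
  suffices hmain : ∃ η : ℝ, (∫ w, (g w - a₀) ∂(Q x) - ∫ w, (g w - a₀) ∂(Q y) ≤
      c * (2 + b * (lam * s + 2 * L) - η)) ∧
      2 + b * (lam * s + 2 * L) - η ≤ a * (2 + b * s) by
    obtain ⟨η, h1, h2⟩ := hmain
    rw [hhval, hhval] at h1
    have := mul_le_mul_of_nonneg_left h2 hc
    show ∫ w, g w ∂(Q x) - ∫ w, g w ∂(Q y) ≤ a * c * (2 + b * s)
    linarith
  by_cases hR : s ≤ 4 * (L + 1) / (1 - lam)
  · have hx : (W x : ℝ) ≤ 4 * (L + 1) / (1 - lam) := by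
      have := (W y).coe_nonneg; simp only [hs] at hR; linarith
    have hy : (W y : ℝ) ≤ 4 * (L + 1) / (1 - lam) := by
      have := (W x).coe_nonneg; simp only [hs] at hR; linarith
    refine ⟨2 * ε', ?_, ?_⟩
    · have hTν : c * ε' ≤ ∫ w, T w ∂ν := by
        have h1 : ∫ _, c ∂ν ≤ ∫ w, T w ∂ν := by
          refine integral_mono (integrable_const c) ((hTint x).mono_measure (hminor x hx)) ?_
          intro w
          have : 0 ≤ b * W w := mul_nonneg hb0.le (W w).coe_nonneg
          simp only [hT]; nlinarith
        have h2 : c * ε' ≤ ∫ _, c ∂ν := by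
          rw [integral_const, smul_eq_mul, mul_comm]
          exact mul_le_mul_of_nonneg_right (hεε'.trans hν) hc
        exact h2.trans h1
      have := integral_sub_le_of_minorization (hminor x hx) (hminor y hy) (hh x) (hh y)
        (hTint x) (hTint y) hcen
      have h1 := hTval x
      have h2 := hTval y
      simp only [hs]
      linarith
    · have h1 : 2 * (1 - ε' / 2) ≤ 2 * a := by linarith
      have h2 : b * s * lam ≤ b * s * a := by
        apply mul_le_mul_of_nonneg_left _ (by positivity); linarith
      nlinarith
  · refine ⟨0, ?_, ?_⟩
    · have hzero : (0 : Measure α) ≤ Q x := Measure.zero_le _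
      have := integral_sub_le_of_minorization hzero (Measure.zero_le (Q y)) (hh x) (hh y)
        (hTint x) (hTint y) hcen
      have h1 := hTval x
      have h2 := hTval y
      simp only [integral_zero_measure] at this
      simp only [hs]
      linarith
    · push Not at hR
      have h1 : 4 * (L + 1) < s * (1 - lam) := (div_lt_iff₀ (by linarith)).1 hR
      have h2 : b * s * ((1 + lam) / 2) ≤ b * s * a :=
        mul_le_mul_of_nonneg_left ha2 (by positivity)
      have h3 : b * (4 * (L + 1)) ≤ b * (s * (1 - lam)) :=
        mul_le_mul_of_nonneg_left h1.le hb0.le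
      nlinarith

/-- Iterated contraction of weighted oscillations. -/
theorem oscLe_pow [Nonempty α] (Q : Kernel α α) [IsMarkovKernel Q] {W : α → ℝ≥0}
    {b a : ℝ} (ha : 0 < a)
    (hint : ∀ n x, Integrable (fun y => (W y : ℝ)) ((Q ^ n) x))
    (hstep : ∀ g : α → ℝ, Measurable g → ∀ c, 0 ≤ c →
      OscLe W b g c → OscLe W b (fun x => ∫ y, g y ∂(Q x)) (a * c))
    {g : α → ℝ} (hg : Measurable g) {c : ℝ} (hc : 0 ≤ c) (hosc : OscLe W b g c) (k : ℕ) :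
    OscLe W b (fun x => ∫ y, g y ∂((Q ^ k) x)) (a ^ k * c) := by
  induction k with
  | zero =>
    have hEq : (fun x => ∫ y, g y ∂((Q ^ 0) x)) = g := by
      funext x; rw [kernel_pow_zero, integral_dirac' _ _ hg.stronglyMeasurable]
    rwa [hEq, pow_zero, one_mul]
  | succ k ih =>
    have hEq : (fun x => ∫ y, g y ∂((Q ^ (k + 1)) x)) =
        fun x => ∫ y, ∫ z, g z ∂((Q ^ k) y) ∂(Q x) := by
      funext x
      rw [integral_pow_add Q k 1 x (hosc.integrable hg (hint _ x)), pow_one]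
    rw [hEq, pow_succ', mul_assoc]
    exact hstep _ (hg.stronglyMeasurable.integral_kernel (κ := Q ^ k)).measurable _
      (by positivity) ih

/-- A contraction by `a` every `m` steps is a geometric rate per step. -/
theorem exists_rate {a : ℝ} (ha0 : 0 < a) (ha : a < 1) {m : ℕ} (hm : 0 < m) :
    ∃ ρ : ℝ, 0 ≤ ρ ∧ ρ < 1 ∧ ∀ n : ℕ, a ^ (n / m) ≤ a⁻¹ * ρ ^ n := by
  refine ⟨a ^ (1 / m : ℝ), by positivity, Real.rpow_lt_one ha0.le ha (by positivity), fun n => ?_⟩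
  have h1 : (a ^ (1 / m : ℝ)) ^ m = a := by
    rw [one_div]; exact Real.rpow_inv_natCast_pow ha0.le hm.ne'
  have h2 : a ^ (n / m + 1) ≤ (a ^ (1 / m : ℝ)) ^ n := by
    conv_lhs => rw [← h1, ← pow_mul]
    refine pow_le_pow_of_le_one (by positivity)
      (Real.rpow_le_one ha0.le ha.le (by positivity)) ?_
    have := Nat.lt_mul_div_succ n hm
    exact this.le
  rw [pow_succ] at h2
  rw [inv_mul_eq_div, le_div_iff₀ ha0]
  exact h2

/-- **Harris' theorem**: a Markov kernel with geometric drift towards the sublevel sets of `W`, on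
each of which some iterate is minorized by a nonzero measure, and with an invariant probability
measure, converges geometrically in the `(1 + W)`-norm. -/
theorem harris_geometric [Nonempty α] (P : Kernel α α) [IsMarkovKernel P] {W : α → ℝ≥0}
    (hW : Measurable W) {lam L : ℝ≥0} (hlam : lam < 1)
    (hdrift : ∀ x, ∫⁻ y, W y ∂(P x) ≤ lam * W x + L)
    (hminor : ∀ R : ℝ, ∃ (m : ℕ) (ν : Measure α), 0 < m ∧ IsFiniteMeasure ν ∧ ν ≠ 0 ∧
      ∀ x, (W x : ℝ) ≤ R → ν ≤ (P ^ m) x)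
    (μ : Measure α) [IsProbabilityMeasure μ] (hinv : P.Invariant μ)
    (hμ : Integrable (fun y => (W y : ℝ)) μ) :
    ∃ C ρ : ℝ, 0 ≤ ρ ∧ ρ < 1 ∧ ∀ (n : ℕ) (x : α) (f : α → ℝ), Measurable f →
      (∀ y, |f y| ≤ 1 + W y) →
      |∫ y, f y ∂((P ^ n) x) - ∫ y, f y ∂μ| ≤ C * ρ ^ n * (1 + W x) := by
  have hpow := lintegral_pow_le_of_drift P hW hlam hdrift
  set L' : ℝ≥0 := L / (1 - lam) with hL'
  have hPint : ∀ n x, Integrable (fun y => (W y : ℝ)) ((P ^ n) x) := fun n x =>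
    (integrable_coe_of_lintegral_le hW (hpow n x)).1
  have hPval : ∀ n x, ∫ y, (W y : ℝ) ∂((P ^ n) x) ≤ lam ^ n * W x + L' := fun n x => by
    simpa using (integrable_coe_of_lintegral_le hW (hpow n x)).2
  obtain ⟨m, ν, hm, hνfin, hν0, hle⟩ := hminor (4 * (L' + 1) / (1 - lam))
  have hlam' : (lam : ℝ) < 1 := by exact_mod_cast hlam
  obtain ⟨b, a, hb0, hb1, ha0, ha1, hstep⟩ := exists_oscLe_contraction (P ^ m) (W := W)
    (lam := lam) (L := L') hlam' L'.coe_nonneg (hPint m)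
    (fun x => (hPval m x).trans (by
      have : (lam : ℝ) ^ m ≤ lam := pow_le_of_le_one lam.coe_nonneg hlam'.le hm.ne'
      have := mul_le_mul_of_nonneg_right this (W x).coe_nonneg
      linarith))
    (ε := ν.real Set.univ) (by
      rw [measureReal_def]
      exact ENNReal.toReal_pos (by simpa using hν0) (measure_ne_top _ _))
    ν le_rfl hle
  obtain ⟨ρ, hρ0, hρ1, hρ⟩ := exists_rate ha0 ha1 hm
  set A : ℝ := 1 + L' with hA
  have hA1 : 0 ≤ A := by have := L'.coe_nonneg; positivity
  set B : ℝ := 2 + ∫ y, (W y : ℝ) ∂μ with hB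
  have hμ0 : 0 ≤ ∫ y, (W y : ℝ) ∂μ := integral_nonneg fun y => (W y).coe_nonneg
  refine ⟨A / b * B * a⁻¹, ρ, hρ0, hρ1, fun n x f hf hfW => ?_⟩
  have hfint : ∀ n x, Integrable f ((P ^ n) x) := fun n x =>
    ((integrable_const (1 : ℝ)).add (hPint n x)).mono' hf.aestronglyMeasurable
      (Eventually.of_forall hfW)
  -- an iterate of `f` has controlled weighted oscillation, whatever the number of steps
  have hosc₀ : ∀ r, OscLe W b (fun x => ∫ y, f y ∂((P ^ r) x)) (A / b) := by
    intro r
    have habs : ∀ x, |∫ y, f y ∂((P ^ r) x)| ≤ A * (1 + W x) := by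
      intro x
      calc |∫ y, f y ∂((P ^ r) x)| ≤ ∫ y, |f y| ∂((P ^ r) x) := abs_integral_le_integral_abs
        _ ≤ ∫ y, (1 + (W y : ℝ)) ∂((P ^ r) x) :=
          integral_mono (hfint r x).abs ((integrable_const _).add (hPint r x)) hfW
        _ = 1 + ∫ y, (W y : ℝ) ∂((P ^ r) x) := by
          rw [integral_add (integrable_const _) (hPint r x)]; simp
        _ ≤ A * (1 + W x) := by
          have h1 := hPval r x
          have h2 : (lam : ℝ) ^ r * W x ≤ 1 * W x :=
            mul_le_mul_of_nonneg_right (pow_le_one₀ lam.coe_nonneg hlam'.le) (W x).coe_nonneg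
          have h3 : 0 ≤ (L' : ℝ) * W x := mul_nonneg L'.coe_nonneg (W x).coe_nonneg
          simp only [hA]; nlinarith
    intro x y
    have h1 := abs_le.1 (habs x)
    have h2 := abs_le.1 (habs y)
    have h3 : A / b * (2 + b * (W x + W y)) = A * (2 / b + (W x + W y)) := by field_simp
    have h4 : (2 : ℝ) ≤ 2 / b := by rw [le_div_iff₀ hb0]; linarith
    have h5 := mul_le_mul_of_nonneg_left h4 hA1
    rw [h3]
    linarith
  have hosc : OscLe W b (fun x => ∫ y, f y ∂((P ^ n) x)) (a ^ (n / m) * (A / b)) := by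
    have h1 := oscLe_pow (P ^ m) ha0 (fun k x => by rw [← pow_mul]; exact hPint _ x) hstep
      (hf.stronglyMeasurable.integral_kernel (κ := P ^ (n % m))).measurable
      (by positivity) (hosc₀ (n % m)) (n / m)
    have h2 : ∀ x, ∫ y, ∫ z, f z ∂((P ^ (n % m)) y) ∂(((P ^ m) ^ (n / m)) x) =
        ∫ y, f y ∂((P ^ n) x) := by
      intro x
      rw [← pow_mul, ← integral_pow_add P (n % m) (m * (n / m)) x (hfint _ x), Nat.mod_add_div]
    simpa only [h2] using h1
  have hinvn : ∀ n, μ.bind ⇑(P ^ n) = μ := by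
    intro n
    induction n with
    | zero => rw [pow_zero]; exact Measure.bind_dirac
    | succ n ih =>
      have : μ.bind ⇑(P ^ (n + 1)) = (μ.bind ⇑(P ^ n)).bind ⇑P := by
        rw [pow_succ']; exact Measure.comp_assoc.symm
      rw [this, ih, hinv.def]
  have hfμ : Integrable f μ := ((integrable_const (1 : ℝ)).add hμ).mono' hf.aestronglyMeasurable
      (Eventually.of_forall hfW)
  have hμf : ∫ y, f y ∂μ = ∫ y, ∫ z, f z ∂((P ^ n) y) ∂μ := by
    conv_lhs => rw [← hinvn n]
    exact integral_bind_kernel (by rw [hinvn n]; exact hfμ)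
  have hPfμ : Integrable (fun y => ∫ z, f z ∂((P ^ n) y)) μ :=
    hosc.integrable (hf.stronglyMeasurable.integral_kernel (κ := P ^ n)).measurable hμ
  have hdiff : ∫ y, f y ∂((P ^ n) x) - ∫ y, f y ∂μ =
      ∫ y, (∫ z, f z ∂((P ^ n) x) - ∫ z, f z ∂((P ^ n) y)) ∂μ := by
    rw [hμf, integral_sub (integrable_const _) hPfμ]; simp
  have hTμ : Integrable (fun y => 2 + b * ((W x : ℝ) + W y)) μ :=
    (integrable_const _).add (((integrable_const _).add hμ).const_mul b)
  rw [hdiff]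
  calc |∫ y, (∫ z, f z ∂((P ^ n) x) - ∫ z, f z ∂((P ^ n) y)) ∂μ|
      ≤ ∫ y, |∫ z, f z ∂((P ^ n) x) - ∫ z, f z ∂((P ^ n) y)| ∂μ := abs_integral_le_integral_abs
    _ ≤ ∫ y, a ^ (n / m) * (A / b) * (2 + b * (W x + W y)) ∂μ := by
      refine integral_mono ((integrable_const _).sub hPfμ).abs
        (hTμ.const_mul _) ?_
      intro y
      refine abs_le.2 ⟨?_, hosc x y⟩
      have := hosc y x
      simp only at this
      rw [add_comm (W y : ℝ)] at this
      linarith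
    _ = a ^ (n / m) * (A / b) * (2 + b * (W x + ∫ y, (W y : ℝ) ∂μ)) := by
      rw [integral_const_mul]
      congr 1
      have h1 : ∀ y, 2 + b * ((W x : ℝ) + W y) = (2 + b * W x) + b * W y := fun y => by ring
      simp only [h1]
      rw [integral_add (integrable_const _) (hμ.const_mul b), integral_const_mul]
      simp
      ring
    _ ≤ (a⁻¹ * ρ ^ n) * (A / b) * (B * (1 + W x)) := by
      have hWx := (W x).coe_nonneg
      have h1 : 2 + b * (W x + ∫ y, (W y : ℝ) ∂μ) ≤ B * (1 + W x) := by
        have h2 : b * (W x + ∫ y, (W y : ℝ) ∂μ) ≤ 1 * (W x + ∫ y, (W y : ℝ) ∂μ) :=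
          mul_le_mul_of_nonneg_right hb1 (by positivity)
        have h3 : 0 ≤ (∫ y, (W y : ℝ) ∂μ) * W x := mul_nonneg hμ0 hWx
        simp only [hB]; nlinarith
      have := hρ n
      gcongr
    _ = A / b * B * a⁻¹ * ρ ^ n * (1 + W x) := by ring

end Harris

/-! ### Kernels killed upon leaving a set -/

section Killed

variable {α : Type*} {mα : MeasurableSpace α}

open Classical in
/-- The sub-Markov kernel that moves according to `κ` from states in `S` and kills the process at
states outside `S`. -/
noncomputable def killedKernel (κ : Kernel α α) {S : Set α} (hS : MeasurableSet S) : Kernel α α :=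
  Kernel.piecewise hS κ 0

variable {κ : Kernel α α} {S : Set α} {hS : MeasurableSet S}

theorem lintegral_killedKernel (x : α) (f : α → ℝ≥0∞) :
    ∫⁻ y, f y ∂(killedKernel κ hS x) = S.indicator (fun x => ∫⁻ y, f y ∂(κ x)) x := by
  classical
  rw [killedKernel, Kernel.lintegral_piecewise]
  by_cases hx : x ∈ S <;> simp [hx]

theorem lintegral_killedKernel_le (x : α) (f : α → ℝ≥0∞) :
    ∫⁻ y, f y ∂(killedKernel κ hS x) ≤ ∫⁻ y, f y ∂(κ x) := by
  rw [lintegral_killedKernel]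
  exact Set.indicator_le_self' (fun _ _ => zero_le) x

theorem lintegral_killedKernel_pow_le (n : ℕ) (x : α) {f : α → ℝ≥0∞} (hf : Measurable f) :
    ∫⁻ y, f y ∂((killedKernel κ hS ^ n) x) ≤ ∫⁻ y, f y ∂((κ ^ n) x) := by
  induction n generalizing x with
  | zero => rw [pow_zero, pow_zero]
  | succ n ih =>
    rw [lintegral_pow_succ _ _ _ hf, lintegral_pow_succ _ _ _ hf]
    exact (lintegral_killedKernel_le x _).trans (lintegral_mono ih)

/-- The process survives one more step only if it is in `S`. -/
theorem killedKernel_pow_succ_univ_le [IsMarkovKernel κ] (n : ℕ) (x : α) :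
    (killedKernel κ hS ^ (n + 1)) x Set.univ ≤ (κ ^ n) x S := by
  have h1 : ∀ y, ∫⁻ _, 1 ∂(killedKernel κ hS y) = S.indicator 1 y := fun y => by
    rw [lintegral_killedKernel]; by_cases hy : y ∈ S <;> simp [hy]
  rw [← lintegral_one, lintegral_pow_succ' _ _ _ measurable_const]
  simp only [h1]
  refine (lintegral_killedKernel_pow_le n x (measurable_one.indicator hS)).trans ?_
  rw [lintegral_indicator_one hS]

/-- If the kernel `κ` has geometric drift with Lyapunov function `W`, and if the process leaves `S`
with a probability that is bounded below on each sublevel set of `W`, then some iterate of the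
killed kernel contracts the Lyapunov function `s + W`, for a large constant `s`. -/
theorem exists_killed_contraction [IsMarkovKernel κ] {W : α → ℝ≥0} (hW : Measurable W)
    {lam L : ℝ≥0} (hlam : lam < 1) (hdrift : ∀ x, ∫⁻ y, W y ∂(κ x) ≤ lam * W x + L)
    (hexit : ∀ R : ℝ≥0, ∃ (n : ℕ) (ε : ℝ≥0), 0 < ε ∧ ∀ x, W x ≤ R → ε ≤ (κ ^ n) x Sᶜ) :
    ∃ (m : ℕ) (s ρ : ℝ≥0), 1 ≤ s ∧ ρ < 1 ∧
      ∀ x, ∫⁻ y, ((s + W y : ℝ≥0) : ℝ≥0∞) ∂((killedKernel κ hS ^ m) x) ≤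
        (ρ * (s + W x) : ℝ≥0) := by
  set L' : ℝ≥0 := L / (1 - lam) with hL'
  obtain ⟨n, ε₀, hε₀, hexit⟩ := hexit (2 * (1 + L') / (1 - lam))
  obtain ⟨ε, hε, hε1, hεε₀⟩ : ∃ ε : ℝ≥0, 0 < ε ∧ ε ≤ 1 ∧ ε ≤ ε₀ :=
    ⟨min ε₀ 1, lt_min hε₀ one_pos, min_le_right _ _, min_le_left _ _⟩
  -- The sublevel set was fixed before `s`, as `ε` depends on it. On it the loss of mass `s ε`
  -- outweighs `L'`; off it drift does, provided that `(1 - ρ) s ≤ 1`.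
  set s : ℝ≥0 := max 1 (2 * L' / ε) with hs
  have hs1 : 1 ≤ s := le_max_left _ _
  have hsε : 2 * (L' : ℝ) ≤ s * ε := by
    have : 2 * L' / ε ≤ s := le_max_right _ _
    rw [div_le_iff₀ hε] at this
    exact_mod_cast this
  set ρ : ℝ≥0 := max (max (1 - ε / 2) ((1 + lam) / 2)) (1 - 1 / s) with hρ
  have hρ1 : 1 - (ε : ℝ) / 2 ≤ ρ := by
    have h1 : 1 - ε / 2 ≤ ρ := (le_max_left _ _).trans (le_max_left _ _)
    have h2 : (1 : ℝ≥0) ≤ ρ + ε / 2 := tsub_le_iff_right.1 h1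
    have h3 : (1 : ℝ) ≤ ρ + ε / 2 := by exact_mod_cast h2
    linarith
  have hρ2 : (1 + (lam : ℝ)) / 2 ≤ ρ := by
    have h1 : (1 + lam) / 2 ≤ ρ := (le_max_right _ _).trans (le_max_left _ _)
    exact_mod_cast h1
  have hρ3 : (1 : ℝ) - 1 / s ≤ ρ := by
    have h1 : 1 - 1 / s ≤ ρ := le_max_right _ _
    have h2 : (1 : ℝ≥0) ≤ ρ + 1 / s := tsub_le_iff_right.1 h1
    have h3 : (1 : ℝ) ≤ ρ + 1 / s := by exact_mod_cast h2
    linarith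
  have hs0 : (0 : ℝ) < s := by exact_mod_cast (one_pos.trans_le hs1)
  have hlam' : (lam : ℝ) < 1 := by exact_mod_cast hlam
  have hε' : (0 : ℝ) < ε := by exact_mod_cast hε
  have hε1' : (ε : ℝ) ≤ 1 := by exact_mod_cast hε1
  refine ⟨n + 1, s, ρ, hs1, ?_, fun x => ?_⟩
  · refine max_lt (max_lt (tsub_lt_self one_pos (by positivity)) ?_)
      (tsub_lt_self one_pos (by positivity))
    have : (1 + (lam : ℝ)) / 2 < 1 := by linarith
    exact_mod_cast this
  have hW' : Measurable fun y => (W y : ℝ≥0∞) := hW.coe_nnreal_ennreal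
  have hsplit : ∫⁻ y, ((s + W y : ℝ≥0) : ℝ≥0∞) ∂((killedKernel κ hS ^ (n + 1)) x) =
      s * (killedKernel κ hS ^ (n + 1)) x Set.univ +
        ∫⁻ y, W y ∂((killedKernel κ hS ^ (n + 1)) x) := by
    simp only [ENNReal.coe_add]
    rw [lintegral_add_left measurable_const, lintegral_const]
  have hWpow : ∫⁻ y, W y ∂((killedKernel κ hS ^ (n + 1)) x) ≤ (lam * W x + L' : ℝ≥0) := by
    refine (lintegral_killedKernel_pow_le _ x hW').trans
      ((lintegral_pow_le_of_drift κ hW hlam hdrift _ x).trans ?_)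
    have : lam ^ (n + 1) ≤ lam := pow_le_of_le_one zero_le hlam.le (Nat.succ_ne_zero n)
    exact_mod_cast add_le_add (mul_le_mul_left this (W x)) le_rfl
  have huniv := killedKernel_pow_succ_univ_le (κ := κ) (hS := hS) n x
  rw [hsplit]
  have hWx : (0 : ℝ) ≤ W x := NNReal.coe_nonneg _
  by_cases hR : W x ≤ 2 * (1 + L') / (1 - lam)
  · have hmass : (killedKernel κ hS ^ (n + 1)) x Set.univ ≤ (1 - ε : ℝ≥0) := by
      refine huniv.trans ?_
      have h1 : (κ ^ n) x S = 1 - (κ ^ n) x Sᶜ := by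
        rw [← prob_compl_eq_one_sub hS.compl, compl_compl]
      rw [h1, ENNReal.coe_sub, ENNReal.coe_one]
      exact tsub_le_tsub_left ((ENNReal.coe_le_coe.2 hεε₀).trans (hexit x hR)) 1
    calc s * (killedKernel κ hS ^ (n + 1)) x Set.univ +
          ∫⁻ y, W y ∂((killedKernel κ hS ^ (n + 1)) x)
        ≤ s * (1 - ε : ℝ≥0) + (lam * W x + L' : ℝ≥0) := by gcongr
      _ = (s * (1 - ε) + (lam * W x + L') : ℝ≥0) := by push_cast; rfl
      _ ≤ (ρ * (s + W x) : ℝ≥0) := by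
        rw [ENNReal.coe_le_coe, ← NNReal.coe_le_coe]
        push_cast [NNReal.coe_sub hε1]
        have h1 : (lam : ℝ) * W x ≤ ρ * W x := mul_le_mul_of_nonneg_right (by linarith) hWx
        have h2 : (1 - (ε : ℝ) / 2) * s ≤ ρ * s := mul_le_mul_of_nonneg_right hρ1 hs0.le
        nlinarith
  · have hmass : (killedKernel κ hS ^ (n + 1)) x Set.univ ≤ 1 := huniv.trans prob_le_one
    calc s * (killedKernel κ hS ^ (n + 1)) x Set.univ +
          ∫⁻ y, W y ∂((killedKernel κ hS ^ (n + 1)) x)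
        ≤ s * 1 + (lam * W x + L' : ℝ≥0) := by gcongr
      _ = (s + (lam * W x + L') : ℝ≥0) := by push_cast; rw [mul_one]
      _ ≤ (ρ * (s + W x) : ℝ≥0) := by
        rw [ENNReal.coe_le_coe, ← NNReal.coe_le_coe]
        push_cast
        have hlt : 2 * (1 + L') < W x * (1 - lam) :=
          (div_lt_iff₀ (tsub_pos_of_lt hlam)).1 (not_le.1 hR)
        have hlt' : 2 * (1 + (L' : ℝ)) < W x * (1 - lam) := by
          have : ((2 * (1 + L') : ℝ≥0) : ℝ) < (W x * (1 - lam) : ℝ≥0) := by exact_mod_cast hlt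
          push_cast [NNReal.coe_sub hlam.le] at this
          exact this
        have h1 : (1 - 1 / (s : ℝ)) * s ≤ ρ * s := mul_le_mul_of_nonneg_right hρ3 hs0.le
        have h2 : (1 - 1 / (s : ℝ)) * s = s - 1 := by field_simp
        have h3 : (1 + (lam : ℝ)) / 2 * W x ≤ ρ * W x := mul_le_mul_of_nonneg_right hρ2 hWx
        nlinarith

/-- **Comparison theorem**: if `∫ H dκ + U ≤ H`, then the expected total of `U` is at most `H`. -/
theorem tsum_lintegral_pow_le_of_supersolution (κ : Kernel α α) {U H : α → ℝ≥0∞}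
    (hU : Measurable U) (hH : Measurable H) (h : ∀ x, ∫⁻ y, H y ∂(κ x) + U x ≤ H x) (x : α) :
    ∑' n : ℕ, ∫⁻ y, U y ∂((κ ^ n) x) ≤ H x := by
  rw [ENNReal.tsum_eq_iSup_nat]
  refine iSup_le fun N => ?_
  suffices hN : ∑ n ∈ Finset.range N, ∫⁻ y, U y ∂((κ ^ n) x) + ∫⁻ y, H y ∂((κ ^ N) x) ≤ H x from
    le_self_add.trans hN
  induction N with
  | zero => rw [lintegral_pow_zero _ _ hH]; simp
  | succ N ih =>
    refine le_trans ?_ ih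
    rw [Finset.sum_range_succ, add_assoc]
    gcongr
    rw [lintegral_pow_succ' _ _ _ hH, ← lintegral_add_left hU]
    refine lintegral_mono fun y => ?_
    rw [add_comm]
    exact h y

/-- Under the conditions of `exists_killed_contraction` the expected total of `1 + W` before the
killing time is at most proportional to the initial value of `1 + W`. -/
theorem exists_tsum_killedKernel_le [IsMarkovKernel κ] {W : α → ℝ≥0} (hW : Measurable W)
    {lam L : ℝ≥0} (hlam : lam < 1) (hdrift : ∀ x, ∫⁻ y, W y ∂(κ x) ≤ lam * W x + L)
    (hexit : ∀ R : ℝ≥0, ∃ (n : ℕ) (ε : ℝ≥0), 0 < ε ∧ ∀ x, W x ≤ R → ε ≤ (κ ^ n) x Sᶜ) :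
    ∃ B : ℝ≥0, ∀ x, ∑' n : ℕ, ∫⁻ y, ((1 + W y : ℝ≥0) : ℝ≥0∞) ∂((killedKernel κ hS ^ n) x) ≤
      (B * (1 + W x) : ℝ≥0) := by
  obtain ⟨m, s, ρ, hs, hρ, hcontr⟩ := exists_killed_contraction (hS := hS) hW hlam hdrift hexit
  set K := killedKernel κ hS with hK
  set U : α → ℝ≥0∞ := fun y => ((s + W y : ℝ≥0) : ℝ≥0∞) with hUdef
  have hU : Measurable U := (measurable_const.add hW).coe_nnreal_ennreal
  set L' : ℝ≥0 := L / (1 - lam) with hL'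
  have hUpow : ∀ n x, ∫⁻ y, U y ∂((K ^ n) x) ≤ (s + (W x + L') : ℝ≥0) := by
    intro n x
    refine (lintegral_killedKernel_pow_le n x hU).trans ?_
    simp only [hUdef, ENNReal.coe_add]
    rw [lintegral_add_left measurable_const]
    refine add_le_add (by simp) ((lintegral_pow_le_of_drift κ hW hlam hdrift n x).trans ?_)
    have : lam ^ n * W x ≤ 1 * W x := mul_le_mul_left (pow_le_one₀ zero_le hlam.le) _
    rw [one_mul] at this
    exact_mod_cast add_le_add this le_rfl
  -- the Lyapunov function `H`, the total of `U` over `m` steps, has drift proportional to `U`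
  set H : α → ℝ≥0∞ := fun x => ∑ i ∈ Finset.range m, ∫⁻ y, U y ∂((K ^ i) x) with hHdef
  have hH : Measurable H := by
    refine Finset.measurable_fun_sum _ fun i _ => ?_
    exact hU.lintegral_kernel
  have hstep : ∀ x, ∫⁻ y, H y ∂(K x) + ((1 - ρ : ℝ≥0) : ℝ≥0∞) * U x ≤ H x := by
    intro x
    have h1 : ∫⁻ y, H y ∂(K x) = ∑ i ∈ Finset.range m, ∫⁻ y, U y ∂((K ^ (i + 1)) x) := by
      simp only [hHdef]
      rw [lintegral_finsetSum _ fun i _ => hU.lintegral_kernel]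
      exact Finset.sum_congr rfl fun i _ => (lintegral_pow_succ _ _ _ hU).symm
    have h2 : ∫⁻ y, H y ∂(K x) + U x = H x + ∫⁻ y, U y ∂((K ^ m) x) := by
      rw [h1, ← lintegral_pow_zero K x hU, ← Finset.sum_range_succ' (fun i => ∫⁻ y, U y ∂((K ^ i) x)),
        Finset.sum_range_succ]
    have h3 : (ρ : ℝ≥0∞) * U x + ((1 - ρ : ℝ≥0) : ℝ≥0∞) * U x = U x := by
      rw [← add_mul, ← ENNReal.coe_add, add_tsub_cancel_of_le hρ.le, ENNReal.coe_one, one_mul]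
    have h4 : ∫⁻ y, U y ∂((K ^ m) x) ≤ ρ * U x := by
      simpa [hUdef] using hcontr x
    have hfin : (ρ : ℝ≥0∞) * U x ≠ ∞ := ENNReal.mul_ne_top ENNReal.coe_ne_top ENNReal.coe_ne_top
    refine (ENNReal.add_le_add_iff_left hfin).1 ?_
    calc (ρ : ℝ≥0∞) * U x + (∫⁻ y, H y ∂(K x) + ((1 - ρ : ℝ≥0) : ℝ≥0∞) * U x)
        = ∫⁻ y, H y ∂(K x) + U x := by rw [add_left_comm, h3]
      _ ≤ ρ * U x + H x := by rw [h2, add_comm]; gcongr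
  have hcomp := tsum_lintegral_pow_le_of_supersolution K (hU.const_mul _) hH hstep
  have hρ0 : (1 - ρ) ≠ 0 := (tsub_pos_of_lt hρ).ne'
  refine ⟨(1 - ρ)⁻¹ * (m * (s + L')), fun x => ?_⟩
  have h5 : ∑' n : ℕ, ∫⁻ y, ((1 + W y : ℝ≥0) : ℝ≥0∞) ∂((K ^ n) x) ≤
      ((1 - ρ)⁻¹ : ℝ≥0) * H x := by
    calc ∑' n : ℕ, ∫⁻ y, ((1 + W y : ℝ≥0) : ℝ≥0∞) ∂((K ^ n) x)
        ≤ ∑' n : ℕ, ((1 - ρ)⁻¹ : ℝ≥0) * ∫⁻ y, ((1 - ρ : ℝ≥0) : ℝ≥0∞) * U y ∂((K ^ n) x) := by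
          refine ENNReal.tsum_le_tsum fun n => ?_
          rw [lintegral_const_mul _ hU, ← mul_assoc, ← ENNReal.coe_mul, inv_mul_cancel₀ hρ0,
            ENNReal.coe_one, one_mul]
          refine lintegral_mono fun y => ?_
          simp only [hUdef]
          gcongr
      _ ≤ ((1 - ρ)⁻¹ : ℝ≥0) * H x := by
          rw [ENNReal.tsum_mul_left]
          gcongr
          exact hcomp x
  refine h5.trans ?_
  have h6 : H x ≤ (m * (s + (W x + L')) : ℝ≥0) := by
    calc H x ≤ ∑ _i ∈ Finset.range m, ((s + (W x + L') : ℝ≥0) : ℝ≥0∞) :=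
          Finset.sum_le_sum fun i _ => hUpow i x
      _ = (m * (s + (W x + L')) : ℝ≥0) := by
          rw [Finset.sum_const, Finset.card_range, nsmul_eq_mul]; push_cast; rfl
  calc (((1 - ρ)⁻¹ : ℝ≥0) : ℝ≥0∞) * H x ≤ ((1 - ρ)⁻¹ : ℝ≥0) * (m * (s + (W x + L')) : ℝ≥0) := by
        gcongr
    _ = ((1 - ρ)⁻¹ * (m * (s + (W x + L'))) : ℝ≥0) := by push_cast; rfl
    _ ≤ ((1 - ρ)⁻¹ * (m * (s + L')) * (1 + W x) : ℝ≥0) := by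
        rw [ENNReal.coe_le_coe]
        have h7 : s + (W x + L') ≤ (s + L') * (1 + W x) := by
          calc s + (W x + L') = (s + L') + 1 * W x := by ring
            _ ≤ (s + L') + (s + L') * W x := by
              gcongr
              exact hs.trans le_self_add
            _ = (s + L') * (1 + W x) := by ring
        calc (1 - ρ)⁻¹ * (m * (s + (W x + L'))) ≤ (1 - ρ)⁻¹ * (m * ((s + L') * (1 + W x))) := by
              gcongr
          _ = (1 - ρ)⁻¹ * (m * (s + L')) * (1 + W x) := by ring

end Killed

namespace Industry

variable {E : Industry} {δ : ℝ}

/-! ### The weight `κ` -/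

namespace Conditions

theorem β_pos (hE : E.Conditions δ) : 0 < E.β := by
  have := hE.r_pos
  unfold β; positivity

theorem δ_pos (hE : E.Conditions δ) : 0 < δ := hE.β_pos.trans hE.δ_mem.1

theorem ratio_nonneg (hE : E.Conditions δ) : 0 ≤ E.β / δ :=
  (div_pos hE.β_pos hE.δ_pos).le

theorem ratio_lt_one (hE : E.Conditions δ) : E.β / δ < 1 :=
  (div_lt_one hE.δ_pos).2 hE.δ_mem.1

theorem one_le_profit_add_shift (hE : E.Conditions δ) (φ p : ℝ≥0) :
    1 ≤ E.profit φ p + E.shift := by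
  have : E.profit 0 0 ≤ E.profit φ p :=
    hE.profit_monotone (show ((0 : ℝ≥0), (0 : ℝ≥0)) ≤ (φ, p) from ⟨zero_le, zero_le⟩)
  unfold shift; linarith

theorem profit_mono (hE : E.Conditions δ) {φ φ' p p' : ℝ≥0} (h : φ ≤ φ') (h' : p ≤ p') :
    E.profit φ p ≤ E.profit φ' p' :=
  hE.profit_monotone (show (φ, p) ≤ (φ', p') from ⟨h, h'⟩)

theorem measurable_profit (hE : E.Conditions δ) (p : ℝ≥0) : Measurable fun x => E.profit x p :=
  Monotone.measurable fun _ _ h => hE.profit_mono h le_rfl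

theorem monotone_ofReal (hE : E.Conditions δ) (p : ℝ≥0) :
    Monotone fun x => ENNReal.ofReal (E.profit x p + E.shift) := fun _ _ h =>
  ENNReal.ofReal_le_ofReal (add_le_add_left (hE.profit_mono h le_rfl) _)

theorem kappa_mono (hE : E.Conditions δ) {φ φ' p p' : ℝ≥0} (h : φ ≤ φ') (h' : p ≤ p') :
    E.kappa δ φ p ≤ E.kappa δ φ' p' := by
  refine ENNReal.tsum_le_tsum fun t => mul_le_mul_right ?_ _
  calc ∫⁻ x, ENNReal.ofReal (E.profit x p + E.shift) ∂((E.Γ ^ t) φ)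
      ≤ ∫⁻ x, ENNReal.ofReal (E.profit x p + E.shift) ∂((E.Γ ^ t) φ') :=
        lintegral_pow_mono_of_stochMono hE.Γ_monotone (hE.monotone_ofReal p) t h
    _ ≤ _ := lintegral_mono fun x =>
        ENNReal.ofReal_le_ofReal (add_le_add_left (hE.profit_mono le_rfl h') _)

theorem measurable_kappa (hE : E.Conditions δ) (p : ℝ≥0) : Measurable fun x => E.kappa δ x p :=
  Monotone.measurable fun _ _ h => hE.kappa_mono h le_rfl

theorem lintegral_kappa_γ_lt_top (hE : E.Conditions δ) (p : ℝ≥0) :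
    ∫⁻ φ, E.kappa δ φ p ∂E.γ < ∞ := by
  have hδ := hE.δ_pos
  have hm := (hE.monotone_ofReal p).measurable
  simp only [kappa]
  rw [lintegral_tsum fun t => (hm.lintegral_kernel.const_mul _).aemeasurable]
  have hterm : ∀ t : ℕ, ∫⁻ φ, ENNReal.ofReal (δ ^ t) *
      ∫⁻ x, ENNReal.ofReal (E.profit x p + E.shift) ∂((E.Γ ^ t) φ) ∂E.γ =
      ENNReal.ofReal (δ ^ t * ∫ x, E.profit x p ∂(E.γ.bind ⇑(E.Γ ^ t)) + δ ^ t * E.shift) := by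
    intro t
    have hint : Integrable (fun x => E.profit x p + E.shift) (E.γ.bind ⇑(E.Γ ^ t)) :=
      (hE.integrable_profit p t).add (integrable_const _)
    rw [lintegral_const_mul _ hm.lintegral_kernel,
      ← Measure.lintegral_bind (Kernel.aemeasurable _) hm.aemeasurable,
      ← ofReal_integral_eq_lintegral_ofReal hint
        (Eventually.of_forall fun x => zero_le_one.trans (hE.one_le_profit_add_shift x p)),
      ← ENNReal.ofReal_mul (by positivity),
      integral_add (hE.integrable_profit p t) (integrable_const _)]
    simp [mul_add]
  simp only [hterm]
  refine lt_top_iff_ne_top.2 (Summable.tsum_ofReal_ne_top ?_)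
  exact (hE.summable_profit p).add
    ((summable_geometric_of_lt_one hδ.le hE.δ_mem.2).mul_right _)

theorem kappa_lt_top (hE : E.Conditions δ) (φ p : ℝ≥0) : E.kappa δ φ p < ∞ := by
  by_cases hγ : E.γ.IsOpenPosMeasure
  · -- `κ(·, p)` is `γ`-integrable, hence finite at some point above `φ`
    have h1 := ae_lt_top (hE.measurable_kappa p) (hE.lintegral_kappa_γ_lt_top p).ne
    have h2 : E.γ (Set.Ioi φ) ≠ 0 :=
      (isOpen_Ioi.measure_pos E.γ ⟨φ + 1, by simp⟩).ne'
    obtain ⟨x, hx, hx'⟩ := (Measure.exists_mem_of_measure_ne_zero_of_ae h2 (ae_restrict_of_ae h1))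
    exact (hE.kappa_mono (le_of_lt hx) le_rfl).trans_lt hx'
  · exact hE.kappa_finite hγ φ p

theorem lintegral_kappa_le (hE : E.Conditions δ) (φ p : ℝ≥0) :
    ENNReal.ofReal δ * ∫⁻ x, E.kappa δ x p ∂(E.Γ φ) ≤ E.kappa δ φ p := by
  have hm := (hE.monotone_ofReal p).measurable
  have h1 : ENNReal.ofReal δ * ∫⁻ x, E.kappa δ x p ∂(E.Γ φ) =
      ∑' t : ℕ, ENNReal.ofReal (δ ^ (t + 1)) *
        ∫⁻ x, ENNReal.ofReal (E.profit x p + E.shift) ∂((E.Γ ^ (t + 1)) φ) := by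
    simp only [kappa]
    rw [lintegral_tsum fun t => (hm.lintegral_kernel.const_mul _).aemeasurable,
      ← ENNReal.tsum_mul_left]
    refine tsum_congr fun t => ?_
    rw [lintegral_const_mul _ hm.lintegral_kernel, ← mul_assoc, pow_succ' δ,
      ENNReal.ofReal_mul hE.δ_pos.le, lintegral_pow_succ _ _ _ hm]
  rw [h1]
  conv_rhs => rw [kappa, tsum_eq_zero_add' ENNReal.summable]
  exact le_add_self

theorem lintegral_pow_kappa_le (hE : E.Conditions δ) (n : ℕ) (φ p : ℝ≥0) :
    ENNReal.ofReal (δ ^ n) * ∫⁻ x, E.kappa δ x p ∂((E.Γ ^ n) φ) ≤ E.kappa δ φ p := by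
  have hm := hE.measurable_kappa p
  induction n with
  | zero => rw [lintegral_pow_zero _ _ hm]; simp
  | succ n ih =>
    refine le_trans ?_ ih
    rw [lintegral_pow_succ' _ _ _ hm, pow_succ, ENNReal.ofReal_mul (pow_nonneg hE.δ_pos.le n),
      mul_assoc, ← lintegral_const_mul _ hm.lintegral_kernel]
    gcongr with x
    exact hE.lintegral_kappa_le x p

theorem ofReal_profit_le_kappa (hE : E.Conditions δ) (φ p : ℝ≥0) :
    ENNReal.ofReal (E.profit φ p + E.shift) ≤ E.kappa δ φ p := by
  have := ENNReal.le_tsum (f := fun t : ℕ => ENNReal.ofReal (δ ^ t) *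
    ∫⁻ x, ENNReal.ofReal (E.profit x p + E.shift) ∂((E.Γ ^ t) φ)) 0
  rw [lintegral_pow_zero _ _ (hE.monotone_ofReal p).measurable] at this
  simpa [kappa] using this

theorem profit_add_shift_le_kappa (hE : E.Conditions δ) (φ p : ℝ≥0) :
    E.profit φ p + E.shift ≤ (E.kappa δ φ p).toReal :=
  (ENNReal.ofReal_le_iff_le_toReal (hE.kappa_lt_top φ p).ne).1 (hE.ofReal_profit_le_kappa φ p)

theorem one_le_kappa (hE : E.Conditions δ) (φ p : ℝ≥0) : 1 ≤ (E.kappa δ φ p).toReal :=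
  (hE.one_le_profit_add_shift φ p).trans (hE.profit_add_shift_le_kappa φ p)

theorem abs_profit_le (hE : E.Conditions δ) (φ p : ℝ≥0) :
    |E.profit φ p| ≤ (1 + |E.shift|) * (E.kappa δ φ p).toReal := by
  have h1 := hE.one_le_kappa φ p
  have h2 := hE.profit_add_shift_le_kappa φ p
  have h3 := hE.one_le_profit_add_shift φ p
  have h4 : |E.profit φ p| ≤ (E.profit φ p + E.shift) + |E.shift| := by
    calc |E.profit φ p| = |(E.profit φ p + E.shift) - E.shift| := by ring_nf
      _ ≤ |E.profit φ p + E.shift| + |E.shift| := abs_sub _ _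
      _ = _ := by rw [abs_of_nonneg (by linarith)]
  nlinarith [abs_nonneg E.shift]

theorem kappa_toReal_mono (hE : E.Conditions δ) {φ φ' p p' : ℝ≥0} (h : φ ≤ φ') (h' : p ≤ p') :
    (E.kappa δ φ p).toReal ≤ (E.kappa δ φ' p').toReal :=
  ENNReal.toReal_mono (hE.kappa_lt_top _ _).ne (hE.kappa_mono h h')

theorem integrable_kappa_γ (hE : E.Conditions δ) (p : ℝ≥0) :
    Integrable (fun x => (E.kappa δ x p).toReal) E.γ :=
  integrable_toReal_of_lintegral_ne_top (hE.measurable_kappa p).aemeasurable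
    (hE.lintegral_kappa_γ_lt_top p).ne

theorem integrable_kappa_pow (hE : E.Conditions δ) (n : ℕ) (φ p : ℝ≥0) :
    Integrable (fun x => (E.kappa δ x p).toReal) ((E.Γ ^ n) φ) ∧
      ∫ x, (E.kappa δ x p).toReal ∂((E.Γ ^ n) φ) ≤ (E.kappa δ φ p).toReal / δ ^ n := by
  have hδ : 0 < δ ^ n := pow_pos hE.δ_pos n
  have h1 := hE.lintegral_pow_kappa_le n φ p
  have hfin : ∫⁻ x, E.kappa δ x p ∂((E.Γ ^ n) φ) ≠ ∞ := by
    intro htop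
    rw [htop, ENNReal.mul_top (by simpa using hδ)] at h1
    exact (h1.trans_lt (hE.kappa_lt_top φ p)).ne rfl
  refine ⟨integrable_toReal_of_lintegral_ne_top (hE.measurable_kappa p).aemeasurable hfin, ?_⟩
  rw [integral_toReal (hE.measurable_kappa p).aemeasurable
    (Eventually.of_forall fun x => hE.kappa_lt_top x p), le_div_iff₀ hδ]
  have h2 := ENNReal.toReal_mono (hE.kappa_lt_top φ p).ne h1
  rw [ENNReal.toReal_mul, ENNReal.toReal_ofReal hδ.le] at h2
  linarith

/-! ### `κ`-bounded functions -/

theorem integrable_γ_of_le_kappa (hE : E.Conditions δ) {u : ℝ≥0 → ℝ} (hu : Measurable u) {C : ℝ}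
    {p : ℝ≥0} (h : ∀ x, |u x| ≤ C * (E.kappa δ x p).toReal) : Integrable u E.γ :=
  ((hE.integrable_kappa_γ p).const_mul C).mono' hu.aestronglyMeasurable (Eventually.of_forall h)

theorem integrable_pow_of_le_kappa (hE : E.Conditions δ) {u : ℝ≥0 → ℝ} (hu : Measurable u) {C : ℝ}
    {p : ℝ≥0} (h : ∀ x, |u x| ≤ C * (E.kappa δ x p).toReal) (n : ℕ) (φ : ℝ≥0) :
    Integrable u ((E.Γ ^ n) φ) :=
  ((hE.integrable_kappa_pow n φ p).1.const_mul C).mono' hu.aestronglyMeasurable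
    (Eventually.of_forall h)

theorem nonneg_of_le_kappa (hE : E.Conditions δ) {u : ℝ≥0 → ℝ} {C : ℝ}
    {p : ℝ≥0} (h : ∀ x, |u x| ≤ C * (E.kappa δ x p).toReal) : 0 ≤ C := by
  have h1 := (abs_nonneg _).trans (h 0)
  exact nonneg_of_mul_nonneg_left h1 (zero_lt_one.trans_le (hE.one_le_kappa 0 p))

theorem integral_pow_le_of_le_kappa (hE : E.Conditions δ) {u : ℝ≥0 → ℝ} {C : ℝ} (hC : 0 ≤ C)
    {p : ℝ≥0} (h : ∀ x, u x ≤ C * (E.kappa δ x p).toReal) (n : ℕ) (φ : ℝ≥0) :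
    ∫ x, u x ∂((E.Γ ^ n) φ) ≤ C * (E.kappa δ φ p).toReal / δ ^ n := by
  have hk := hE.integrable_kappa_pow n φ p
  have hδ := hE.δ_pos
  by_cases hu : Integrable u ((E.Γ ^ n) φ)
  · calc ∫ x, u x ∂((E.Γ ^ n) φ) ≤ ∫ x, C * (E.kappa δ x p).toReal ∂((E.Γ ^ n) φ) :=
          integral_mono hu (hk.1.const_mul C) h
      _ ≤ C * ((E.kappa δ φ p).toReal / δ ^ n) := by
          rw [integral_const_mul]; exact mul_le_mul_of_nonneg_left hk.2 hC
      _ = _ := by ring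
  · rw [integral_undef hu]; positivity

theorem abs_integral_pow_le_of_le_kappa (hE : E.Conditions δ) {u : ℝ≥0 → ℝ} {C : ℝ}
    {p : ℝ≥0} (h : ∀ x, |u x| ≤ C * (E.kappa δ x p).toReal) (n : ℕ) (φ : ℝ≥0) :
    |∫ x, u x ∂((E.Γ ^ n) φ)| ≤ C * (E.kappa δ φ p).toReal / δ ^ n :=
  abs_integral_le_integral_abs.trans
    (hE.integral_pow_le_of_le_kappa (hE.nonneg_of_le_kappa h) h n φ)

end Conditions

namespace MemC

variable {u : ℝ≥0 → ℝ≥0 → ℝ}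

theorem mono (hu : E.MemC δ u) {φ φ' p p' : ℝ≥0} (h : φ ≤ φ') (h' : p ≤ p') :
    u φ p ≤ u φ' p' :=
  hu.monotone (show (φ, p) ≤ (φ', p') from ⟨h, h'⟩)

theorem measurable (hu : E.MemC δ u) (p : ℝ≥0) : Measurable fun x => u x p :=
  Monotone.measurable fun _ _ h => hu.mono h le_rfl

theorem integrable_pow (hu : E.MemC δ u) (hE : E.Conditions δ) (n : ℕ) (φ p : ℝ≥0) :
    Integrable (fun x => u x p) ((E.Γ ^ n) φ) := by
  obtain ⟨C, hC⟩ := hu.bounded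
  exact hE.integrable_pow_of_le_kappa (hu.measurable p) (fun x => hC x p) n φ

theorem integrable_Γ (hu : E.MemC δ u) (hE : E.Conditions δ) (φ p : ℝ≥0) :
    Integrable (fun x => u x p) (E.Γ φ) := by
  simpa using hu.integrable_pow hE 1 φ p

theorem integrable_γ (hu : E.MemC δ u) (hE : E.Conditions δ) (p : ℝ≥0) :
    Integrable (fun x => u x p) E.γ := by
  obtain ⟨C, hC⟩ := hu.bounded
  exact hE.integrable_γ_of_le_kappa (hu.measurable p) (fun x => hC x p)

theorem integral_mono (hu : E.MemC δ u) (hE : E.Conditions δ) {φ φ' p p' : ℝ≥0}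
    (h : φ ≤ φ') (h' : p ≤ p') : ∫ x, u x p ∂(E.Γ φ) ≤ ∫ x, u x p' ∂(E.Γ φ') :=
  (MeasureTheory.integral_mono (hu.integrable_Γ hE φ p) (hu.integrable_Γ hE φ p')
    fun _ => hu.mono le_rfl h').trans
  (integral_mono_of_stochMono hE.Γ_monotone (fun _ _ h => hu.mono h le_rfl)
    (fun x => hu.integrable_Γ hE x p') h)

end MemC

/-! ### The value function -/

theorem MemC.zero : E.MemC δ fun _ _ => 0 :=
  ⟨continuous_const, monotone_const, 0, by simp⟩

/-- The Bellman operator maps `𝒞` to itself. -/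
theorem MemC.bellman {u : ℝ≥0 → ℝ≥0 → ℝ} (hu : E.MemC δ u) (hE : E.Conditions δ) :
    E.MemC δ (E.bellman u) := by
  have hβ := hE.β_pos
  refine ⟨?_, ?_, ?_⟩
  · exact hE.profit_continuous.add
      (continuous_const.mul (continuous_const.max (hE.continuous_integral u hu)))
  · rintro ⟨φ, p⟩ ⟨φ', p'⟩ ⟨h, h'⟩
    refine add_le_add (hE.profit_mono h h') (mul_le_mul_of_nonneg_left ?_ hβ.le)
    exact max_le_max le_rfl (hu.integral_mono hE h h')
  · obtain ⟨C, hC⟩ := hu.bounded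
    refine ⟨1 + |E.shift| + C * (E.β / δ), fun φ p => ?_⟩
    have h1 := hE.abs_profit_le φ p
    have h2 := hE.abs_integral_pow_le_of_le_kappa (fun x => hC x p) 1 φ
    rw [pow_one, pow_one] at h2
    have h3 : |max 0 (∫ x, u x p ∂(E.Γ φ))| ≤ |∫ x, u x p ∂(E.Γ φ)| := by
      rw [abs_of_nonneg (le_max_left _ _)]
      exact max_le (abs_nonneg _) (le_abs_self _)
    calc |E.bellman u φ p| ≤ |E.profit φ p| + |E.β * max 0 (∫ x, u x p ∂(E.Γ φ))| := abs_add_le _ _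
      _ ≤ (1 + |E.shift|) * (E.kappa δ φ p).toReal +
          E.β * (C * (E.kappa δ φ p).toReal / δ) := by
        rw [abs_mul, abs_of_pos hβ]
        gcongr
        exact h3.trans h2
      _ = _ := by ring

/-- The Bellman operator contracts `κ`-weighted distances by the factor `β / δ`. -/
theorem Conditions.abs_bellman_sub_le (hE : E.Conditions δ) {u w : ℝ≥0 → ℝ≥0 → ℝ}
    (hu : E.MemC δ u) (hw : E.MemC δ w) {C : ℝ}
    (h : ∀ φ p, |u φ p - w φ p| ≤ C * (E.kappa δ φ p).toReal) (φ p : ℝ≥0) :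
    |E.bellman u φ p - E.bellman w φ p| ≤ E.β / δ * C * (E.kappa δ φ p).toReal := by
  have hβ := hE.β_pos
  have h2 := hE.abs_integral_pow_le_of_le_kappa (fun x => h x p) 1 φ
  rw [pow_one, pow_one, integral_sub (hu.integrable_Γ hE φ p) (hw.integrable_Γ hE φ p)] at h2
  have h3 : E.bellman u φ p - E.bellman w φ p =
      E.β * (max 0 (∫ x, u x p ∂(E.Γ φ)) - max 0 (∫ x, w x p ∂(E.Γ φ))) := by
    simp only [Industry.bellman]; ring
  rw [h3, abs_mul, abs_of_pos hβ]
  have h4 := abs_max_sub_max_le_abs (∫ x, u x p ∂(E.Γ φ)) (∫ x, w x p ∂(E.Γ φ)) 0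
  rw [max_comm _ 0, max_comm _ 0] at h4
  calc E.β * |max 0 (∫ x, u x p ∂(E.Γ φ)) - max 0 (∫ x, w x p ∂(E.Γ φ))|
      ≤ E.β * (C * (E.kappa δ φ p).toReal / δ) := by gcongr; exact h4.trans h2
    _ = _ := by ring

theorem Conditions.isValueFunction_unique (hE : E.Conditions δ) {v w : ℝ≥0 → ℝ≥0 → ℝ}
    (hv : E.IsValueFunction δ v) (hw : E.IsValueFunction δ w) : w = v := by
  obtain ⟨C, hC⟩ := hw.1.bounded
  obtain ⟨C', hC'⟩ := hv.1.bounded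
  have hn : ∀ n : ℕ, ∀ φ p, |w φ p - v φ p| ≤
      ((E.β / δ) ^ n * (C + C')) * (E.kappa δ φ p).toReal := by
    intro n
    induction n with
    | zero =>
      intro φ p
      have := abs_sub (w φ p) (v φ p)
      have h1 := hC φ p
      have h2 := hC' φ p
      rw [pow_zero, one_mul, add_mul]
      linarith
    | succ n ih =>
      intro φ p
      have := hE.abs_bellman_sub_le hw.1 hv.1 ih φ p
      rw [hw.2, hv.2] at this
      rwa [pow_succ', mul_assoc (E.β / δ)]
  funext φ p
  have hlim : Tendsto (fun n : ℕ => ((E.β / δ) ^ n * (C + C')) * (E.kappa δ φ p).toReal) atTop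
      (𝓝 0) := by
    simpa using ((tendsto_pow_atTop_nhds_zero_of_lt_one hE.ratio_nonneg hE.ratio_lt_one).mul_const
      (C + C')).mul_const (E.kappa δ φ p).toReal
  have : |w φ p - v φ p| ≤ 0 := ge_of_tendsto' hlim fun n => hn n φ p
  exact sub_eq_zero.1 (abs_nonpos_iff.1 this)

theorem Conditions.exists_isValueFunction (hE : E.Conditions δ) :
    ∃ v, E.IsValueFunction δ v := by
  set θ := E.β / δ with hθ
  have hθ0 : 0 ≤ θ := hE.ratio_nonneg
  have hθ1 : θ < 1 := hE.ratio_lt_one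
  set V : ℕ → ℝ≥0 → ℝ≥0 → ℝ := fun n => E.bellman^[n] fun _ _ => 0 with hV
  have hVs : ∀ n, V (n + 1) = E.bellman (V n) := fun n => Function.iterate_succ_apply' _ _ _
  have hmem : ∀ n, E.MemC δ (V n) := by
    intro n
    induction n with
    | zero => exact MemC.zero
    | succ n ih => rw [hVs]; exact ih.bellman hE
  set A : ℝ := 1 + |E.shift| with hA
  have hA0 : 0 ≤ A := by positivity
  have hstep : ∀ n φ p, |V n φ p - V (n + 1) φ p| ≤ θ ^ n * A * (E.kappa δ φ p).toReal := by
    intro n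
    induction n with
    | zero =>
      intro φ p
      have : V 0 φ p - V (0 + 1) φ p = - E.profit φ p := by
        rw [hVs]; simp [hV, Industry.bellman]
      rw [this, abs_neg, pow_zero, one_mul]
      exact hE.abs_profit_le φ p
    | succ n ih =>
      intro φ p
      have := hE.abs_bellman_sub_le (hmem n) (hmem (n + 1)) ih φ p
      rwa [← hVs, ← hVs, ← mul_assoc, ← pow_succ'] at this
  have hdist : ∀ φ p n, dist (V n φ p) (V (n + 1) φ p) ≤ (A * (E.kappa δ φ p).toReal) * θ ^ n := by
    intro φ p n
    rw [Real.dist_eq]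
    exact (hstep n φ p).trans_eq (by ring)
  have hex : ∀ φ p, ∃ l, Tendsto (fun n => V n φ p) atTop (𝓝 l) := fun φ p =>
    cauchySeq_tendsto_of_complete (cauchySeq_of_le_geometric _ _ hθ1 (hdist φ p))
  choose v hv using hex
  have hrate : ∀ n φ p, |V n φ p - v φ p| ≤ (A / (1 - θ) * θ ^ n) * (E.kappa δ φ p).toReal := by
    intro n φ p
    have := dist_le_of_le_geometric_of_tendsto _ _ hθ1 (hdist φ p) (hv φ p) n
    rw [Real.dist_eq] at this
    exact this.trans_eq (by ring)
  have hvmem : E.MemC δ v := by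
    refine ⟨?_, ?_, A / (1 - θ), fun φ p => ?_⟩
    · -- on `[0, a] × [0, b]` the weight is at most `κ(a, b)`, so the convergence is locally uniform
      have hloc : TendstoLocallyUniformly (fun n => Function.uncurry (V n)) (Function.uncurry v)
          atTop := by
        rw [Metric.tendstoLocallyUniformly_iff]
        intro ε hε x
        have hlim : Tendsto (fun n : ℕ => (A / (1 - θ) * θ ^ n) *
            (E.kappa δ (x.1 + 1) (x.2 + 1)).toReal) atTop (𝓝 0) := by
          simpa using ((tendsto_pow_atTop_nhds_zero_of_lt_one hθ0 hθ1).const_mul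
            (A / (1 - θ))).mul_const (E.kappa δ (x.1 + 1) (x.2 + 1)).toReal
        refine ⟨Set.Iio (x.1 + 1) ×ˢ Set.Iio (x.2 + 1),
          prod_mem_nhds (Iio_mem_nhds (by simp)) (Iio_mem_nhds (by simp)), ?_⟩
        filter_upwards [hlim.eventually (gt_mem_nhds hε)] with n hn y hy
        rw [dist_comm, Real.dist_eq]
        refine lt_of_le_of_lt ((hrate n y.1 y.2).trans ?_) hn
        have : 0 < 1 - θ := by linarith
        exact mul_le_mul_of_nonneg_left (hE.kappa_toReal_mono (le_of_lt hy.1) (le_of_lt hy.2))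
          (by positivity)
      exact hloc.continuous (Eventually.of_forall fun n => (hmem n).continuous).frequently
    · intro x y hxy
      exact le_of_tendsto_of_tendsto' (hv x.1 x.2) (hv y.1 y.2) fun n => (hmem n).monotone hxy
    · have := hrate 0 φ p
      simpa [hV] using this
  refine ⟨v, hvmem, ?_⟩
  funext φ p
  have h1 : ∀ n, |V (n + 1) φ p - E.bellman v φ p| ≤
      θ * (A / (1 - θ) * θ ^ n) * (E.kappa δ φ p).toReal := fun n => by
    rw [hVs]; exact hE.abs_bellman_sub_le (hmem n) hvmem (hrate n) φ p
  have h2 : Tendsto (fun n : ℕ => θ * (A / (1 - θ) * θ ^ n) * (E.kappa δ φ p).toReal) atTop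
      (𝓝 0) := by
    simpa using (((tendsto_pow_atTop_nhds_zero_of_lt_one hθ0 hθ1).const_mul
      (A / (1 - θ))).const_mul θ).mul_const (E.kappa δ φ p).toReal
  have h3 : Tendsto (fun n => V (n + 1) φ p) atTop (𝓝 (E.bellman v φ p)) := by
    rw [tendsto_iff_norm_sub_tendsto_zero]
    exact squeeze_zero (fun _ => norm_nonneg _) h1 h2
  exact tendsto_nhds_unique h3 ((tendsto_add_atTop_iff_nat 1).2 (hv φ p))

end Industry

namespace Industry

variable {E : Industry} {δ : ℝ}

/-! ### The free-entry price -/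

theorem Conditions.γ_Ioi_ne_zero (hE : E.Conditions δ) : E.γ (Set.Ioi 0) ≠ 0 := by
  intro h0
  obtain ⟨p, hp, hce⟩ := hE.exists_entry
  have hae : ∀ᵐ x ∂E.γ, x = 0 := by
    rw [ae_iff]
    convert h0 using 2
    ext x
    simp [pos_iff_ne_zero]
  have h1 : ∫ x, E.profit x p ∂E.γ = E.profit 0 p := by
    rw [integral_congr_ae (g := fun _ => E.profit 0 p)
      (hae.mono fun x hx => by simp only [hx])]
    simp
  have h2 := hE.profit_neg 0 p (Or.inl rfl)
  have h3 := hE.ce_pos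
  linarith

/-- The assumed inequality for discounted profits at zero productivity is strict: unless zero is
absorbing, profits rise strictly with the price, and the weak inequality holds at a higher price. -/
theorem Conditions.tsum_profit_zero_neg (hE : E.Conditions δ) (p : ℝ≥0) :
    Summable (fun t : ℕ => E.β ^ (t + 1) * ∫ x, E.profit x p ∂((E.Γ ^ (t + 1)) 0)) ∧
    ∑' t : ℕ, E.β ^ (t + 1) * ∫ x, E.profit x p ∂((E.Γ ^ (t + 1)) 0) < 0 := by
  have hβ := hE.β_pos
  have hsum : ∀ p, Summable (fun t : ℕ =>
      E.β ^ (t + 1) * ∫ x, E.profit x p ∂((E.Γ ^ (t + 1)) 0)) := by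
    intro p
    have hg := ((summable_nat_add_iff 1).2
      (summable_geometric_of_lt_one hE.ratio_nonneg hE.ratio_lt_one)).mul_left
      ((1 + |E.shift|) * (E.kappa δ 0 p).toReal)
    refine Summable.of_norm_bounded hg fun t => ?_
    have h1 := hE.abs_integral_pow_le_of_le_kappa (fun x => hE.abs_profit_le x p) (t + 1) 0
    rw [Real.norm_eq_abs, abs_mul, abs_of_pos (pow_pos hβ _)]
    calc E.β ^ (t + 1) * |∫ x, E.profit x p ∂((E.Γ ^ (t + 1)) 0)|
        ≤ E.β ^ (t + 1) * ((1 + |E.shift|) * (E.kappa δ 0 p).toReal / δ ^ (t + 1)) := by gcongr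
      _ = _ := by rw [div_pow]; ring
  have hint : ∀ p (t : ℕ), Integrable (fun x => E.profit x p) ((E.Γ ^ t) 0) := fun p t =>
    hE.integrable_pow_of_le_kappa (hE.measurable_profit p) (fun x => hE.abs_profit_le x p) t 0
  refine ⟨hsum p, ?_⟩
  by_cases hpos : ∃ t : ℕ, (E.Γ ^ (t + 1)) 0 (Set.Ioi 0) ≠ 0
  · obtain ⟨t, ht⟩ := hpos
    refine lt_of_lt_of_le ?_ (hE.profit_zero (p + 1))
    have hmono : ∀ x, E.profit x p ≤ E.profit x (p + 1) := fun x =>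
      hE.profit_mono le_rfl le_self_add
    refine Summable.tsum_lt_tsum (i := t) (fun t => ?_) ?_ (hsum p) (hsum (p + 1))
    · exact mul_le_mul_of_nonneg_left (integral_mono (hint _ _) (hint _ _) hmono)
        (pow_pos hβ _).le
    · refine mul_lt_mul_of_pos_left ?_ (pow_pos hβ _)
      rw [← sub_pos, ← integral_sub (hint _ _) (hint _ _),
        integral_pos_iff_support_of_nonneg (fun x => sub_nonneg.2 (hmono x))
          ((hint _ _).sub (hint _ _))]
      refine (pos_iff_ne_zero.2 ht).trans_le (measure_mono fun x hx => ?_)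
      exact (sub_pos.2 (hE.profit_strictMono_right x hx (lt_add_one p))).ne'
  · -- zero is absorbing, and profits there are negative
    push Not at hpos
    have hterm : ∀ t : ℕ, ∫ x, E.profit x p ∂((E.Γ ^ (t + 1)) 0) = E.profit 0 p := by
      intro t
      have hae : ∀ᵐ x ∂((E.Γ ^ (t + 1)) 0), x = 0 := by
        rw [ae_iff]
        convert hpos t using 2
        ext x
        simp [pos_iff_ne_zero]
      rw [integral_congr_ae (g := fun _ => E.profit 0 p) (hae.mono fun x hx => by simp only [hx])]
      simp
    have hneg := hE.profit_neg 0 p (Or.inl rfl)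
    have := hsum p
    simp only [hterm] at this ⊢
    rw [← neg_pos, ← tsum_neg]
    refine this.neg.tsum_pos (fun t => ?_) 0 ?_
    · have := mul_pos (pow_pos hβ (t + 1)) (neg_pos.2 hneg)
      linarith
    · have := mul_pos (pow_pos hβ (0 + 1)) (neg_pos.2 hneg)
      linarith

namespace IsValueFunction

variable {v : ℝ≥0 → ℝ≥0 → ℝ}

theorem eq_bellman (hv : E.IsValueFunction δ v) (φ p : ℝ≥0) :
    v φ p = E.profit φ p + E.β * max 0 (∫ x, v x p ∂(E.Γ φ)) :=
  (congrFun (congrFun hv.2 φ) p).symm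

theorem profit_le (hv : E.IsValueFunction δ v) (hE : E.Conditions δ) (φ p : ℝ≥0) :
    E.profit φ p ≤ v φ p := by
  rw [hv.eq_bellman]
  have := mul_nonneg hE.β_pos.le (le_max_left 0 (∫ x, v x p ∂(E.Γ φ)))
  linarith

theorem lt_of_price_lt (hv : E.IsValueFunction δ v) (hE : E.Conditions δ) {φ p p' : ℝ≥0}
    (hφ : 0 < φ) (hp : p < p') : v φ p < v φ p' := by
  rw [hv.eq_bellman, hv.eq_bellman φ p']
  refine add_lt_add_of_lt_of_le (hE.profit_strictMono_right φ hφ hp)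
    (mul_le_mul_of_nonneg_left ?_ hE.β_pos.le)
  exact max_le_max le_rfl (hv.1.integral_mono hE le_rfl hp.le)

/-- At price zero profits are negative, so a bound `v ≤ c κ` improves by the factor `β / δ` with
each application of the Bellman equation. -/
theorem nonpos_of_price_zero (hv : E.IsValueFunction δ v) (hE : E.Conditions δ) (φ : ℝ≥0) :
    v φ 0 ≤ 0 := by
  obtain ⟨C, hC⟩ := hv.1.bounded
  have hC0 : 0 ≤ C := hE.nonneg_of_le_kappa fun x => hC x 0
  have hn : ∀ n : ℕ, ∀ φ, v φ 0 ≤ (E.β / δ) ^ n * C * (E.kappa δ φ 0).toReal := by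
    intro n
    induction n with
    | zero =>
      intro φ
      rw [pow_zero, one_mul]
      exact (le_abs_self _).trans (hC φ 0)
    | succ n ih =>
      intro φ
      have hβ := hE.β_pos
      have hδ := hE.δ_pos
      have hc : 0 ≤ (E.β / δ) ^ n * C := mul_nonneg (pow_nonneg hE.ratio_nonneg n) hC0
      have h1 := hE.integral_pow_le_of_le_kappa hc ih 1 φ
      rw [pow_one, pow_one] at h1
      have h2 : max 0 (∫ x, v x 0 ∂(E.Γ φ)) ≤
          (E.β / δ) ^ n * C * (E.kappa δ φ 0).toReal / δ := max_le (by positivity) h1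
      have h3 := hE.profit_neg φ 0 (Or.inr rfl)
      rw [hv.eq_bellman]
      calc E.profit φ 0 + E.β * max 0 (∫ x, v x 0 ∂(E.Γ φ))
          ≤ 0 + E.β * ((E.β / δ) ^ n * C * (E.kappa δ φ 0).toReal / δ) := by gcongr
        _ = _ := by rw [pow_succ]; ring
  have hlim : Tendsto (fun n : ℕ => (E.β / δ) ^ n * C * (E.kappa δ φ 0).toReal) atTop (𝓝 0) := by
    simpa using ((tendsto_pow_atTop_nhds_zero_of_lt_one hE.ratio_nonneg hE.ratio_lt_one).mul_const
      C).mul_const (E.kappa δ φ 0).toReal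
  exact ge_of_tendsto' hlim fun n => hn n φ

theorem strictMono_entry (hv : E.IsValueFunction δ v) (hE : E.Conditions δ) :
    StrictMono fun p => ∫ x, v x p ∂E.γ := by
  intro p p' hp
  have hint := hv.1.integrable_γ hE
  show ∫ x, v x p ∂E.γ < ∫ x, v x p' ∂E.γ
  rw [← sub_pos, ← integral_sub (hint _) (hint _), integral_pos_iff_support_of_nonneg
    (fun x => sub_nonneg.2 (hv.1.mono le_rfl hp.le)) ((hint _).sub (hint _))]
  refine (pos_iff_ne_zero.2 hE.γ_Ioi_ne_zero).trans_le (measure_mono fun x hx => ?_)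
  exact (sub_pos.2 (hv.lt_of_price_lt hE hx hp)).ne'

theorem continuous_entry (hv : E.IsValueFunction δ v) (hE : E.Conditions δ) :
    Continuous fun p => ∫ x, v x p ∂E.γ := by
  obtain ⟨C, hC⟩ := hv.1.bounded
  have hC0 : 0 ≤ C := hE.nonneg_of_le_kappa fun x => hC x 0
  refine continuous_iff_continuousAt.2 fun p => ?_
  refine continuousAt_of_dominated (bound := fun x => C * (E.kappa δ x (p + 1)).toReal)
    (Eventually.of_forall fun p => (hv.1.measurable p).aestronglyMeasurable) ?_
    ((hE.integrable_kappa_γ (p + 1)).const_mul C) ?_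
  · filter_upwards [Iio_mem_nhds (lt_add_one p)] with p' hp'
    refine Eventually.of_forall fun x => (hC x p').trans ?_
    exact mul_le_mul_of_nonneg_left (hE.kappa_toReal_mono le_rfl (le_of_lt hp')) hC0
  · exact Eventually.of_forall fun x =>
      (hv.1.continuous.comp (Continuous.prodMk_right x)).continuousAt

/-- At some positive price the value of entry equals the entry cost. -/
theorem exists_entry_eq (hv : E.IsValueFunction δ v) (hE : E.Conditions δ) :
    ∃ p, 0 < p ∧ ∫ x, v x p ∂E.γ = E.ce := by
  obtain ⟨p₁, hp₁, hce⟩ := hE.exists_entry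
  have hint := hv.1.integrable_γ hE
  have h0 : ∫ x, v x 0 ∂E.γ ≤ 0 := integral_nonpos fun x => hv.nonpos_of_price_zero hE x
  have h1 : E.ce ≤ ∫ x, v x p₁ ∂E.γ :=
    hce.trans (integral_mono
      (hE.integrable_γ_of_le_kappa (hE.measurable_profit p₁) fun x => hE.abs_profit_le x p₁)
      (hint p₁) fun x => hv.profit_le hE x p₁)
  have hpos := hE.ce_pos
  obtain ⟨p, -, hp⟩ := intermediate_value_Icc hp₁.le (hv.continuous_entry hE).continuousOn
    ⟨h0.trans hpos.le, h1⟩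
  refine ⟨p, pos_iff_ne_zero.2 ?_, hp⟩
  rintro rfl
  simp only at hp
  linarith

/-! ### The exit threshold -/

/-- A firm with zero productivity exits. Were it to stay, firms would stay forever at every
productivity, and the continuation value at zero would be the sum of discounted profits. -/
theorem integral_Γ_zero_neg (hv : E.IsValueFunction δ v) (hE : E.Conditions δ) (p : ℝ≥0) :
    ∫ x, v x p ∂(E.Γ 0) < 0 := by
  by_contra! hcon
  have hβ := hE.β_pos
  have hstay : ∀ φ, 0 ≤ ∫ x, v x p ∂(E.Γ φ) := fun φ =>
    hcon.trans (hv.1.integral_mono hE zero_le le_rfl)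
  have heq : ∀ φ, v φ p = E.profit φ p + E.β * ∫ x, v x p ∂(E.Γ φ) := fun φ => by
    conv_lhs => rw [hv.eq_bellman, max_eq_right (hstay φ)]
  set a : ℕ → ℝ := fun n => ∫ x, v x p ∂((E.Γ ^ n) 0) with ha
  set π : ℕ → ℝ := fun n => ∫ x, E.profit x p ∂((E.Γ ^ n) 0) with hπ
  have hvint : ∀ n, Integrable (fun x => v x p) ((E.Γ ^ n) 0) := fun n =>
    hv.1.integrable_pow hE n 0 p
  have hπint : ∀ n, Integrable (fun x => E.profit x p) ((E.Γ ^ n) 0) := fun n =>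
    hE.integrable_pow_of_le_kappa (hE.measurable_profit p) (fun x => hE.abs_profit_le x p) n 0
  have hrec : ∀ n, E.β * a (n + 1) = a n - π n := by
    intro n
    have h1 : a (n + 1) = ∫ y, ∫ x, v x p ∂(E.Γ y) ∂((E.Γ ^ n) 0) := by
      simp only [ha]
      rw [add_comm n 1, integral_pow_add E.Γ 1 n 0 (by rw [add_comm]; exact hvint _), pow_one]
    rw [h1, ← integral_const_mul, ← integral_sub (hvint n) (hπint n)]
    refine integral_congr_ae (Eventually.of_forall fun y => ?_)
    have := heq y
    simp only
    linarith
  have hpartial : ∀ n, ∑ t ∈ Finset.range n, E.β ^ (t + 1) * π (t + 1) =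
      E.β * a 1 - E.β ^ (n + 1) * a (n + 1) := by
    intro n
    induction n with
    | zero => simp
    | succ n ih =>
      rw [Finset.sum_range_succ, ih]
      have := hrec (n + 1)
      calc _ = E.β * a 1 - E.β ^ (n + 1) * (a (n + 1) - π (n + 1)) := by ring
        _ = _ := by rw [← this]; ring
  obtain ⟨C, hC⟩ := hv.1.bounded
  have htail : Tendsto (fun n : ℕ => E.β ^ (n + 1) * a (n + 1)) atTop (𝓝 0) := by
    have hlim : Tendsto (fun n : ℕ => C * (E.kappa δ 0 p).toReal * (E.β / δ) ^ (n + 1)) atTop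
        (𝓝 0) := by
      simpa using ((tendsto_add_atTop_iff_nat 1).2 (tendsto_pow_atTop_nhds_zero_of_lt_one
        hE.ratio_nonneg hE.ratio_lt_one)).const_mul (C * (E.kappa δ 0 p).toReal)
    refine squeeze_zero_norm (fun n => ?_) hlim
    have h1 := hE.abs_integral_pow_le_of_le_kappa (fun x => hC x p) (n + 1) 0
    rw [Real.norm_eq_abs, abs_mul, abs_of_pos (pow_pos hβ _)]
    calc E.β ^ (n + 1) * |a (n + 1)|
        ≤ E.β ^ (n + 1) * (C * (E.kappa δ 0 p).toReal / δ ^ (n + 1)) := by gcongr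
      _ = _ := by rw [div_pow]; ring
  obtain ⟨hsum, hneg⟩ := hE.tsum_profit_zero_neg p
  have h1 := hsum.hasSum.tendsto_sum_nat
  have h2 : Tendsto (fun n => ∑ t ∈ Finset.range n, E.β ^ (t + 1) * π (t + 1)) atTop
      (𝓝 (E.β * a 1)) := by
    simp only [hpartial]
    simpa using htail.const_sub (E.β * a 1)
  have h3 := tendsto_nhds_unique h1 h2
  have h4 : a 1 = ∫ x, v x p ∂(E.Γ 0) := by simp only [ha, pow_one]
  rw [h3, h4] at hneg
  exact absurd (mul_nonneg hβ.le hcon) (not_le.2 hneg)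

/-- At positive prices the exit threshold is positive and finite. -/
theorem exists_exitThreshold_eq (hv : E.IsValueFunction δ v) (hE : E.Conditions δ) {p : ℝ≥0}
    (hp : 0 < p) : ∃ a : ℝ≥0, 0 < a ∧ E.exitThreshold v p = a := by
  set T : Set ℝ≥0 := {φ | 0 ≤ ∫ x, v x p ∂(E.Γ φ)} with hT
  have hne : T.Nonempty := by
    obtain ⟨φ, hφ⟩ := hE.exists_stay p hp
    refine ⟨φ, hφ.trans (integral_mono ?_ (hv.1.integrable_Γ hE φ p)
      fun x => hv.profit_le hE x p)⟩
    simpa using hE.integrable_pow_of_le_kappa (hE.measurable_profit p)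
      (fun x => hE.abs_profit_le x p) 1 φ
  have hclosed : IsClosed T := isClosed_le continuous_const
    ((hE.continuous_integral v hv.1).comp (Continuous.prodMk_left p))
  refine ⟨sInf T, pos_iff_ne_zero.2 fun h0 => ?_, ?_⟩
  · have hmem : (0 : ℝ≥0) ∈ T := h0 ▸ hclosed.csInf_mem hne (OrderBot.bddBelow T)
    exact absurd hmem (not_le.2 (hv.integral_Γ_zero_neg hE p))
  · rw [exitThreshold, ENNReal.coe_sInf hne, sInf_image]

end IsValueFunction

theorem staySet_eq_Ici {v : ℝ≥0 → ℝ≥0 → ℝ} {p a : ℝ≥0} (h : E.exitThreshold v p = a) :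
    E.staySet v p = Set.Ici a := by
  ext φ
  simp [staySet, h]

end Industry

namespace Industry

/-! ### The productivity path of a firm -/

variable (E : Industry)

theorem lintegral_pathLaw_zero {f : ℝ≥0 → ℝ≥0∞} (hf : Measurable f) :
    ∫⁻ ω, f (ω 0) ∂E.pathLaw = ∫⁻ φ, f φ ∂E.γ := by
  have hm : Measurable fun ω : ℕ → ℝ≥0 => f (ω 0) := hf.comp (measurable_pi_apply 0)
  rw [pathLaw, Kernel.trajMeasure, Measure.lintegral_bind (Kernel.aemeasurable _) hm.aemeasurable]
  have h1 : ∀ x : (i : Finset.Iic 0) → ℝ≥0, ∫⁻ ω, f (ω 0) ∂(Kernel.traj (X := fun _ => ℝ≥0)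
      (fun n => E.Γ.comap (fun x : (i : Finset.Iic n) → ℝ≥0 => x ⟨n, Finset.mem_Iic.2 le_rfl⟩)
      (measurable_pi_apply _)) 0 x) = f (x ⟨0, Finset.mem_Iic.2 le_rfl⟩) := by
    intro x
    have h2 := Kernel.traj_map_frestrictLe_apply (X := fun _ => ℝ≥0)
      (κ := fun n => E.Γ.comap (fun x : (i : Finset.Iic n) → ℝ≥0 => x ⟨n, Finset.mem_Iic.2 le_rfl⟩)
      (measurable_pi_apply _)) 0 0 x
    rw [Kernel.partialTraj_self, Kernel.id_apply] at h2
    have hg : Measurable fun y : (i : Finset.Iic 0) → ℝ≥0 => f (y ⟨0, Finset.mem_Iic.2 le_rfl⟩) :=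
      hf.comp (measurable_pi_apply _)
    have h3 := lintegral_dirac' x hg
    rw [← h2, lintegral_map hg (Preorder.measurable_frestrictLe 0)] at h3
    exact h3
  simp only [h1]
  have hg : Measurable fun y : (i : Finset.Iic 0) → ℝ≥0 => f (y ⟨0, Finset.mem_Iic.2 le_rfl⟩) :=
    hf.comp (measurable_pi_apply _)
  rw [lintegral_map hg (MeasurableEquiv.measurable _)]
  rfl

/-- The Markov property of the productivity path. -/
theorem lintegral_pathLaw_succ (n : ℕ) {g : ((i : Finset.Iic n) → ℝ≥0) → ℝ≥0∞} (hg : Measurable g)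
    {f : ℝ≥0 → ℝ≥0∞} (hf : Measurable f) :
    ∫⁻ ω, g (Preorder.frestrictLe n ω) * f (ω (n + 1)) ∂E.pathLaw =
      ∫⁻ ω, g (Preorder.frestrictLe n ω) * ∫⁻ y, f y ∂(E.Γ (ω n)) ∂E.pathLaw := by
  have h1 := Kernel.map_frestrictLe_trajMeasure_compProd_eq_map_trajMeasure (X := fun _ => ℝ≥0)
    (μ₀ := E.γ) (κ := fun n => E.Γ.comap
      (fun x : (i : Finset.Iic n) → ℝ≥0 => x ⟨n, Finset.mem_Iic.2 le_rfl⟩)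
      (measurable_pi_apply _)) (a := n)
  have hmeas : Measurable fun z : ((i : Finset.Iic n) → ℝ≥0) × ℝ≥0 => g z.1 * f z.2 :=
    (hg.comp measurable_fst).mul (hf.comp measurable_snd)
  have h2 : ∫⁻ ω, g (Preorder.frestrictLe n ω) * f (ω (n + 1)) ∂E.pathLaw =
      ∫⁻ z, g z.1 * f z.2 ∂(E.pathLaw.map
        fun x => (Preorder.frestrictLe (π := fun _ => ℝ≥0) n x, x (n + 1))) := by
    rw [lintegral_map hmeas (by fun_prop)]
  rw [h2, pathLaw, ← h1, Measure.lintegral_compProd hmeas]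
  have h3 : ∀ x : (i : Finset.Iic n) → ℝ≥0,
      ∫⁻ y, g x * f y ∂(E.Γ.comap
        (fun x : (i : Finset.Iic n) → ℝ≥0 => x ⟨n, Finset.mem_Iic.2 le_rfl⟩)
        (measurable_pi_apply _) x) = g x * ∫⁻ y, f y ∂(E.Γ (x ⟨n, Finset.mem_Iic.2 le_rfl⟩)) := by
    intro x
    rw [lintegral_const_mul _ hf, Kernel.comap_apply]
  simp only [h3]
  have hG : Measurable fun x : (i : Finset.Iic n) → ℝ≥0 =>
      g x * ∫⁻ y, f y ∂(E.Γ (x ⟨n, Finset.mem_Iic.2 le_rfl⟩)) :=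
    hg.mul ((hf.lintegral_kernel (κ := E.Γ)).comp (measurable_pi_apply _))
  rw [lintegral_map hG (by fun_prop)]
  rfl

/-- The law of productivity at date `n + 1` on the event of survival until then is obtained from
`γ` by `n` transitions of the killed kernel. -/
theorem lintegral_pathLaw_killed {S : Set ℝ≥0} (hS : MeasurableSet S) (n : ℕ) {f : ℝ≥0 → ℝ≥0∞}
    (hf : Measurable f) :
    ∫⁻ ω, {ω : ℕ → ℝ≥0 | ∀ i < n, ω i ∈ S}.indicator (fun ω => f (ω n)) ω ∂E.pathLaw =
      ∫⁻ φ, ∫⁻ y, f y ∂((killedKernel E.Γ hS ^ n) φ) ∂E.γ := by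
  induction n generalizing f with
  | zero =>
    simp only [lintegral_pow_zero _ _ hf, not_lt_zero, IsEmpty.forall_iff, implies_true,
      Set.ofPred_true, Set.indicator_univ]
    exact E.lintegral_pathLaw_zero hf
  | succ n ih =>
    have hA : MeasurableSet {x : (i : Finset.Iic n) → ℝ≥0 | ∀ i, x i ∈ S} := by
      rw [Set.ofPred_forall]
      exact MeasurableSet.iInter fun i => measurable_pi_apply i hS
    have hg : Measurable ({x : (i : Finset.Iic n) → ℝ≥0 | ∀ i, x i ∈ S}.indicator
        (1 : ((i : Finset.Iic n) → ℝ≥0) → ℝ≥0∞)) := measurable_one.indicator hA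
    have hiff : ∀ ω : ℕ → ℝ≥0, (∀ i, Preorder.frestrictLe (π := fun _ => ℝ≥0) n ω i ∈ S) ↔
        ∀ i < n + 1, ω i ∈ S := fun ω =>
      ⟨fun h i hi => h ⟨i, Finset.mem_Iic.2 (Nat.lt_succ_iff.1 hi)⟩,
        fun h i => h i (Nat.lt_succ_iff.2 (Finset.mem_Iic.1 i.2))⟩
    have h1 : ∀ (ω : ℕ → ℝ≥0) (c : ℝ≥0∞),
        {x : (i : Finset.Iic n) → ℝ≥0 | ∀ i, x i ∈ S}.indicator (1 : ((i : Finset.Iic n) → ℝ≥0) → ℝ≥0∞)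
          (Preorder.frestrictLe (π := fun _ => ℝ≥0) n ω) * c =
        {ω : ℕ → ℝ≥0 | ∀ i < n + 1, ω i ∈ S}.indicator (fun _ => c) ω := by
      intro ω c
      by_cases h : ∀ i < n + 1, ω i ∈ S
      · rw [Set.indicator_of_mem (by exact (hiff ω).2 h), Set.indicator_of_mem (by exact h),
          Pi.one_apply, one_mul]
      · rw [Set.indicator_of_notMem (by exact fun h' => h ((hiff ω).1 h')),
          Set.indicator_of_notMem (by exact h), zero_mul]
    have h2 := E.lintegral_pathLaw_succ n hg hf
    simp only [h1] at h2
    have h3 : ∀ ω : ℕ → ℝ≥0, {ω : ℕ → ℝ≥0 | ∀ i < n + 1, ω i ∈ S}.indicator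
        (fun _ => ∫⁻ y, f y ∂(E.Γ (ω n))) ω =
        {ω : ℕ → ℝ≥0 | ∀ i < n, ω i ∈ S}.indicator
          (fun ω => ∫⁻ y, f y ∂(killedKernel E.Γ hS (ω n))) ω := by
      intro ω
      have hsucc : (∀ i < n + 1, ω i ∈ S) ↔ (∀ i < n, ω i ∈ S) ∧ ω n ∈ S :=
        Nat.forall_lt_succ_right
      by_cases ha : ∀ i < n, ω i ∈ S
      · rw [Set.indicator_of_mem (s := {ω : ℕ → ℝ≥0 | ∀ i < n, ω i ∈ S}) ha,
          lintegral_killedKernel]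
        by_cases hb : ω n ∈ S
        · rw [Set.indicator_of_mem hb, Set.indicator_of_mem (by exact hsucc.2 ⟨ha, hb⟩)]
        · rw [Set.indicator_of_notMem hb,
            Set.indicator_of_notMem (by exact fun h => hb (hsucc.1 h).2)]
      · rw [Set.indicator_of_notMem (by exact fun h => ha (hsucc.1 h).1),
          Set.indicator_of_notMem (by exact ha)]
    simp only [h3] at h2
    have h4 : ∀ φ, ∫⁻ y, f y ∂((killedKernel E.Γ hS ^ (n + 1)) φ) =
        ∫⁻ y, ∫⁻ z, f z ∂(killedKernel E.Γ hS y) ∂((killedKernel E.Γ hS ^ n) φ) := fun φ =>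
      lintegral_pow_succ' _ _ _ hf
    simp only [h4]
    rw [← ih hf.lintegral_kernel, ← h2]
    exact lintegral_congr fun ω => rfl

theorem le_lifespan_iff (v : ℝ≥0 → ℝ≥0 → ℝ) (p : ℝ≥0) (ω : ℕ → ℝ≥0) (n : ℕ) :
    ((n + 1 : ℕ) : ℕ∞) ≤ E.lifespan v p ω ↔ ∀ i < n, ω i ∈ E.staySet v p := by
  simp only [lifespan, le_iInf_iff, Set.mem_ofPred_eq, staySet, productivity, Nat.cast_le]
  constructor
  · intro h i hi
    by_contra! hcon
    have := h (i + 1) ⟨by omega, by simpa using hcon⟩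
    omega
  · rintro h t ⟨ht, hlt⟩
    by_contra! hcon
    exact absurd hlt (not_lt.2 (h (t - 1) (by omega)))

/-- Expected lifetime sums are sums of integrals with respect to iterates of the kernel killed
upon exit. -/
theorem lifetimeSum_eq_tsum (v : ℝ≥0 → ℝ≥0 → ℝ) (p : ℝ≥0) {f : ℝ≥0 → ℝ≥0∞} (hf : Measurable f) :
    E.lifetimeSum v p f = ∑' n : ℕ, ∫⁻ φ, ∫⁻ y, f y
      ∂((killedKernel E.Γ (E.measurableSet_staySet v p) ^ n) φ) ∂E.γ := by
  classical
  have hS := E.measurableSet_staySet v p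
  have hmeas : ∀ n : ℕ, Measurable ({ω : ℕ → ℝ≥0 | ∀ i < n, ω i ∈ E.staySet v p}.indicator
      fun ω => f (ω n)) := by
    intro n
    refine (hf.comp (measurable_pi_apply n)).indicator ?_
    simp only [Set.ofPred_forall]
    exact MeasurableSet.iInter fun i => MeasurableSet.iInter fun _ => measurable_pi_apply i hS
  have h1 : ∀ ω : ℕ → ℝ≥0, ∑' t : ℕ, (if 1 ≤ t ∧ (t : ℕ∞) ≤ E.lifespan v p ω then
      f (productivity ω t) else 0) =
      ∑' n : ℕ, {ω : ℕ → ℝ≥0 | ∀ i < n, ω i ∈ E.staySet v p}.indicator (fun ω => f (ω n)) ω := by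
    intro ω
    rw [tsum_eq_zero_add' ENNReal.summable, if_neg (by simp), zero_add]
    refine tsum_congr fun n => ?_
    simp only [E.le_lifespan_iff v p ω n, Set.indicator, Set.mem_ofPred_eq, productivity,
      Nat.add_sub_cancel]
    simp
  rw [lifetimeSum]
  have h2 : (∫⁻ ω, ∑' t : ℕ, (if 1 ≤ t ∧ (t : ℕ∞) ≤ E.lifespan v p ω then
      f (productivity ω t) else 0) ∂E.pathLaw) = ∑' n : ℕ, ∫⁻ φ, ∫⁻ y, f y
      ∂((killedKernel E.Γ (E.measurableSet_staySet v p) ^ n) φ) ∂E.γ := by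
    simp only [h1]
    rw [lintegral_tsum fun n => (hmeas n).aemeasurable]
    exact tsum_congr fun n => E.lintegral_pathLaw_killed hS n hf
  convert h2

end Industry

/-! ### Occupation measures and regeneration -/

section Occupation

variable {α : Type*} {mα : MeasurableSpace α}

/-- The expected occupation measure `∑ₙ γ Kⁿ` of the process with initial distribution `γ` and
sub-Markov transition kernel `K`. -/
noncomputable def occupation (γ : Measure α) (K : Kernel α α) : Measure α :=
  Measure.sum fun n : ℕ => γ.bind ⇑(K ^ n)

theorem lintegral_occupation (γ : Measure α) (K : Kernel α α) {f : α → ℝ≥0∞} (hf : Measurable f) :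
    ∫⁻ x, f x ∂(occupation γ K) = ∑' n : ℕ, ∫⁻ x, ∫⁻ y, f y ∂((K ^ n) x) ∂γ := by
  rw [occupation, lintegral_sum_measure]
  exact tsum_congr fun n => Measure.lintegral_bind (Kernel.aemeasurable _) hf.aemeasurable

theorem lintegral_occupation_eq_add (γ : Measure α) (K : Kernel α α) {f : α → ℝ≥0∞}
    (hf : Measurable f) :
    ∫⁻ x, f x ∂(occupation γ K) =
      ∫⁻ x, f x ∂γ + ∫⁻ x, ∫⁻ y, f y ∂(K x) ∂(occupation γ K) := by
  rw [lintegral_occupation γ K hf, lintegral_occupation γ K hf.lintegral_kernel,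
    tsum_eq_zero_add' ENNReal.summable]
  simp only [lintegral_pow_zero _ _ hf, lintegral_pow_succ' _ _ _ hf]

variable {κ : Kernel α α} {S : Set α} {hS : MeasurableSet S} {γ : Measure α}

theorem lintegral_lintegral_killedKernel (μ : Measure α) (f : α → ℝ≥0∞) :
    ∫⁻ x, ∫⁻ y, f y ∂(killedKernel κ hS x) ∂μ = ∫⁻ x in S, ∫⁻ y, f y ∂(κ x) ∂μ := by
  simp only [lintegral_killedKernel]
  exact lintegral_indicator hS _

theorem occupation_apply_eq_add {B : Set α} (hB : MeasurableSet B) :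
    occupation γ (killedKernel κ hS) B =
      γ B + ∫⁻ x in S, κ x B ∂(occupation γ (killedKernel κ hS)) := by
  have h := lintegral_occupation_eq_add γ (killedKernel κ hS) (measurable_one.indicator hB)
  rw [lintegral_lintegral_killedKernel] at h
  simpa only [lintegral_indicator_one hB] using h

/-- The killed process visits the complement of `S` exactly once, at the end of its life, if its
expected lifetime is finite. -/
theorem occupation_compl [IsMarkovKernel κ] [IsProbabilityMeasure γ]
    (hfin : occupation γ (killedKernel κ hS) Set.univ ≠ ∞) :
    occupation γ (killedKernel κ hS) Sᶜ = 1 := by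
  have h1 := occupation_apply_eq_add (κ := κ) (hS := hS) (γ := γ) MeasurableSet.univ
  simp only [measure_univ, lintegral_one, Measure.restrict_apply_univ] at h1
  have h2 := measure_add_measure_compl (μ := occupation γ (killedKernel κ hS)) hS
  have hS' : occupation γ (killedKernel κ hS) S ≠ ∞ := measure_ne_top_of_subset
    (Set.subset_univ S) hfin
  rw [h1, add_comm 1] at h2
  exact (ENNReal.add_right_inj hS').1 h2

open Classical in
/-- Restarting the process from `γ` whenever it leaves `S` makes the occupation measure
invariant. -/
theorem invariant_occupation [IsMarkovKernel κ] [IsProbabilityMeasure γ]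
    (hfin : occupation γ (killedKernel κ hS) Set.univ ≠ ∞) (c : ℝ≥0∞) :
    (Kernel.piecewise hS κ (Kernel.const _ γ)).Invariant
      (c • occupation γ (killedKernel κ hS)) := by
  set μ := occupation γ (killedKernel κ hS) with hμ
  refine Measure.ext fun B hB => ?_
  rw [Measure.bind_apply hB (Kernel.aemeasurable _), lintegral_smul_measure, Measure.smul_apply]
  congr 1
  rw [← lintegral_add_compl _ hS,
    setLIntegral_congr_fun (g := fun x => κ x B) hS
      (fun x hx => by simp only [Kernel.piecewise_apply, if_pos hx]),
    setLIntegral_congr_fun (g := fun _ => γ B) hS.compl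
      (fun x hx => by simp only [Kernel.piecewise_apply, if_neg (show x ∉ S from hx),
        Kernel.const_apply]),
    setLIntegral_const, occupation_compl hfin, mul_one, add_comm]
  exact (occupation_apply_eq_add hB).symm

/-- A finite measure that is stationary for the killed process with immigration `M γ` is `M` times
the occupation measure, if the process dies almost surely. -/
theorem eq_smul_occupation {μ : Measure α} [IsFiniteMeasure μ] {K : Kernel α α} {M : ℝ≥0∞}
    (hK : ∀ n x, (K ^ n) x Set.univ ≤ 1)
    (hlim : ∀ x, Tendsto (fun n => (K ^ n) x Set.univ) atTop (𝓝 0))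
    (hμ : μ = μ.bind K + M • γ) : μ = M • occupation γ K := by
  have hstep : ∀ f : α → ℝ≥0∞, Measurable f →
      ∫⁻ x, f x ∂μ = ∫⁻ x, ∫⁻ y, f y ∂(K x) ∂μ + M * ∫⁻ x, f x ∂γ := by
    intro f hf
    conv_lhs => rw [hμ]
    rw [lintegral_add_measure, lintegral_smul_measure,
      Measure.lintegral_bind (Kernel.aemeasurable _) hf.aemeasurable, smul_eq_mul]
  refine Measure.ext fun B hB => ?_
  have hiter : ∀ n : ℕ, μ B = ∫⁻ x, (K ^ n) x B ∂μ +
      M * ∑ i ∈ Finset.range n, ∫⁻ x, (K ^ i) x B ∂γ := by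
    intro n
    induction n with
    | zero =>
      have h0 : ∀ x, (K ^ 0) x B = B.indicator 1 x := fun x => by
        rw [kernel_pow_zero, Measure.dirac_apply' _ hB]
      simp only [h0, Finset.range_zero, Finset.sum_empty, mul_zero, add_zero,
        lintegral_indicator_one hB]
    | succ n ih =>
      have h1 : ∀ x, ∫⁻ y, (K ^ n) y B ∂(K x) = (K ^ (n + 1)) x B := fun x => by
        rw [pow_succ]; exact (Kernel.comp_apply' _ _ _ hB).symm
      rw [ih, hstep _ (Kernel.measurable_coe _ hB), Finset.sum_range_succ, mul_add]
      simp only [h1]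
      rw [add_assoc, add_comm (M * ∫⁻ x, (K ^ n) x B ∂γ)]
  have h1 : Tendsto (fun n => ∫⁻ x, (K ^ n) x B ∂μ) atTop (𝓝 0) := by
    have := tendsto_lintegral_of_dominated_convergence (μ := μ) (F := fun n x => (K ^ n) x B)
      (f := fun _ => 0) (fun _ => 1) (fun n => Kernel.measurable_coe _ hB)
      (fun n => Eventually.of_forall fun x => (measure_mono (Set.subset_univ B)).trans (hK n x))
      (by simp)
      (Eventually.of_forall fun x => tendsto_of_tendsto_of_tendsto_of_le_of_le tendsto_const_nhds
        (hlim x) (fun _ => zero_le) fun n => measure_mono (Set.subset_univ B))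
    simpa using this
  have h2 : Tendsto (fun n => M * ∑ i ∈ Finset.range n, ∫⁻ x, (K ^ i) x B ∂γ) atTop (𝓝 (μ B)) := by
    have h3 : ∀ n, M * ∑ i ∈ Finset.range n, ∫⁻ x, (K ^ i) x B ∂γ =
        μ B - ∫⁻ x, (K ^ n) x B ∂μ := by
      intro n
      refine ENNReal.eq_sub_of_add_eq ?_ (by rw [add_comm]; exact (hiter n).symm)
      refine ne_top_of_le_ne_top (measure_ne_top μ B) ?_
      rw [hiter n]; exact le_self_add
    simp only [h3]
    simpa using ENNReal.Tendsto.sub (tendsto_const_nhds (x := μ B)) h1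
      (Or.inl (measure_ne_top μ B))
  have h4 : Tendsto (fun n => M * ∑ i ∈ Finset.range n, ∫⁻ x, (K ^ i) x B ∂γ) atTop
      (𝓝 (M * ∑' i, ∫⁻ x, (K ^ i) x B ∂γ)) := by
    have h5 : Monotone fun n => M * ∑ i ∈ Finset.range n, ∫⁻ x, (K ^ i) x B ∂γ := fun i j hij =>
      mul_le_mul_right (Finset.sum_le_sum_of_subset (Finset.range_mono hij)) M
    rw [ENNReal.tsum_eq_iSup_nat, ENNReal.mul_iSup]
    exact tendsto_atTop_iSup h5
  rw [tendsto_nhds_unique h2 h4, Measure.smul_apply, smul_eq_mul,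
    ← lintegral_indicator_one hB, lintegral_occupation _ _ (measurable_one.indicator hB)]
  simp only [lintegral_indicator_one hB]

end Occupation

namespace Industry

variable {E : Industry} {δ : ℝ} {v : ℝ≥0 → ℝ≥0 → ℝ}

/-! ### Lifetimes and ergodicity of the industry -/

theorem Conditions.q_mono (hE : E.Conditions δ) {φ φ' : ℝ≥0} (h : φ ≤ φ') (p : ℝ≥0) :
    E.q φ p ≤ E.q φ' p :=
  hE.q_monotone (show (φ, p) ≤ (φ', p) from ⟨h, le_rfl⟩)

theorem Conditions.measurable_q (hE : E.Conditions δ) (p : ℝ≥0) : Measurable fun φ => E.q φ p :=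
  Monotone.measurable fun _ _ h => hE.q_mono h p

/-- From the sublevel sets of output the process enters `[0, a)` at some date with a probability
that is bounded below. By stochastic monotonicity the largest state of the sublevel set is the
worst one. -/
theorem Conditions.exists_hitting_bound (hE : E.Conditions δ) (hdrift : E.OutputDrift) {p a : ℝ≥0}
    (hp : 0 < p) (ha : 0 < a) (R : ℝ≥0) :
    ∃ (n : ℕ) (ε : ℝ≥0), 0 < ε ∧ ∀ φ, E.q φ p ≤ R → ε ≤ (E.Γ ^ n) φ (Set.Iio a) := by
  obtain ⟨c, hc⟩ := ((hdrift p hp).1.eventually (eventually_gt_atTop R)).exists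
  obtain ⟨n, hn⟩ := hE.Γ_recurrent a ha c
  refine ⟨n, ((E.Γ ^ n) c (Set.Iio a)).toNNReal,
    ENNReal.toNNReal_pos hn.ne' (measure_ne_top _ _), fun φ hφ => ?_⟩
  rw [ENNReal.coe_toNNReal (measure_ne_top _ _)]
  refine pow_Iio_antitone_of_stochMono hE.Γ_monotone n a ?_
  by_contra! hcon
  exact absurd (hE.q_mono hcon.le p) (not_le.2 (hφ.trans_lt hc))

/-- The occupation measure of a firm over its lifetime, at price `p`. -/
noncomputable def lifetimeMeasure (E : Industry) (v : ℝ≥0 → ℝ≥0 → ℝ) (p : ℝ≥0) : Measure ℝ≥0 :=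
  occupation E.γ (killedKernel E.Γ (E.measurableSet_staySet v p))

theorem lifetimeSum_eq_lintegral (p : ℝ≥0) {f : ℝ≥0 → ℝ≥0∞} (hf : Measurable f) :
    E.lifetimeSum v p f = ∫⁻ φ, f φ ∂(E.lifetimeMeasure v p) := by
  rw [lifetimeSum_eq_tsum E v p hf, lifetimeMeasure, lintegral_occupation _ _ hf]

theorem lifetimeMeasure_apply (p : ℝ≥0) {B : Set ℝ≥0} (hB : MeasurableSet B) :
    E.lifetimeMeasure v p B = E.lifetimeSum v p (B.indicator fun _ => 1) := by
  rw [lifetimeSum_eq_lintegral p (measurable_const.indicator hB),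
    lintegral_indicator_const hB, one_mul]

theorem compl_staySet {p a : ℝ≥0} (h : E.exitThreshold v p = a) :
    (E.staySet v p)ᶜ = Set.Iio a := by
  rw [staySet_eq_Ici h, Set.compl_Ici]

theorem IsValueFunction.exists_tsum_killedKernel_le (hv : E.IsValueFunction δ v)
    (hE : E.Conditions δ) (hdrift : E.OutputDrift) {p : ℝ≥0} (hp : 0 < p) :
    ∃ B : ℝ≥0, ∀ φ, ∑' n : ℕ, ∫⁻ y, ((1 + E.q y p : ℝ≥0) : ℝ≥0∞)
      ∂((killedKernel E.Γ (E.measurableSet_staySet v p) ^ n) φ) ≤ (B * (1 + E.q φ p) : ℝ≥0) := by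
  obtain ⟨-, lam, L, -, hlam, hL⟩ := hdrift p hp
  obtain ⟨a, ha, hthr⟩ := hv.exists_exitThreshold_eq hE hp
  refine _root_.exists_tsum_killedKernel_le (hE.measurable_q p) hlam hL fun R => ?_
  rw [compl_staySet hthr]
  exact hE.exists_hitting_bound hdrift hp ha R

theorem IsValueFunction.lintegral_lifetimeMeasure_lt_top (hv : E.IsValueFunction δ v)
    (hE : E.Conditions δ) (hdrift : E.OutputDrift) {p : ℝ≥0} (hp : 0 < p) :
    ∫⁻ φ, ((1 + E.q φ p : ℝ≥0) : ℝ≥0∞) ∂(E.lifetimeMeasure v p) < ∞ := by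
  have hq := hE.measurable_q p
  have hV : Measurable fun φ => ((1 + E.q φ p : ℝ≥0) : ℝ≥0∞) :=
    (measurable_const.add hq).coe_nnreal_ennreal
  obtain ⟨B, hB⟩ := hv.exists_tsum_killedKernel_le hE hdrift hp
  rw [lifetimeMeasure, lintegral_occupation _ _ hV,
    ← lintegral_tsum fun n => hV.lintegral_kernel.aemeasurable]
  refine (lintegral_mono hB).trans_lt ?_
  simp only [ENNReal.coe_mul, ENNReal.coe_add, ENNReal.coe_one]
  have hV' : Measurable fun φ => (1 : ℝ≥0∞) + E.q φ p :=
    measurable_const.add hq.coe_nnreal_ennreal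
  rw [lintegral_const_mul _ hV', lintegral_add_left measurable_const]
  refine ENNReal.mul_lt_top ENNReal.coe_lt_top (ENNReal.add_lt_top.2 ⟨by simp, ?_⟩)
  exact hE.lintegral_q_lt_top p

theorem IsValueFunction.isFiniteMeasure_lifetimeMeasure (hv : E.IsValueFunction δ v)
    (hE : E.Conditions δ) (hdrift : E.OutputDrift) {p : ℝ≥0} (hp : 0 < p) :
    IsFiniteMeasure (E.lifetimeMeasure v p) := by
  refine ⟨lt_of_le_of_lt ?_ (hv.lintegral_lifetimeMeasure_lt_top hE hdrift hp)⟩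
  rw [← lintegral_one]
  refine lintegral_mono fun φ => ?_
  simp

theorem lintegral_endoKernel (φ p : ℝ≥0) (f : ℝ≥0 → ℝ≥0∞) :
    (φ ∈ E.staySet v p → ∫⁻ y, f y ∂(E.endoKernel v p φ) = ∫⁻ y, f y ∂(E.Γ φ)) ∧
    (φ ∉ E.staySet v p → ∫⁻ y, f y ∂(E.endoKernel v p φ) = ∫⁻ y, f y ∂E.γ) := by
  classical
  constructor <;> intro h <;> simp [endoKernel, Kernel.lintegral_piecewise, h]

instance (v : ℝ≥0 → ℝ≥0 → ℝ) (p : ℝ≥0) : IsMarkovKernel (E.endoKernel v p) := by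
  unfold endoKernel; infer_instance

/-- If the productivity process is in the exit region after `n` periods, then the endogenous process
has entered it by then; it is still there if all entrants since have started there. -/
theorem pow_endoKernel_compl_ge (p : ℝ≥0) (n : ℕ) (φ : ℝ≥0) :
    E.γ (E.staySet v p)ᶜ ^ n * (E.Γ ^ n) φ (E.staySet v p)ᶜ ≤
      (E.endoKernel v p ^ n) φ (E.staySet v p)ᶜ := by
  set A := (E.staySet v p)ᶜ with hA
  have hAm : MeasurableSet A := (E.measurableSet_staySet v p).compl
  have hpow : ∀ (κ : Kernel ℝ≥0 ℝ≥0) (n : ℕ) (φ : ℝ≥0),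
      (κ ^ (n + 1)) φ A = ∫⁻ y, (κ ^ n) y A ∂(κ φ) := fun κ n φ => by
    rw [pow_succ]; exact Kernel.comp_apply' _ _ _ hAm
  induction n generalizing φ with
  | zero => rw [pow_zero, one_mul, pow_zero, pow_zero]
  | succ n ih =>
    rw [hpow (E.endoKernel v p)]
    by_cases hφ : φ ∈ E.staySet v p
    · rw [(lintegral_endoKernel φ p _).1 hφ, hpow]
      calc E.γ A ^ (n + 1) * ∫⁻ y, (E.Γ ^ n) y A ∂(E.Γ φ)
          ≤ E.γ A ^ n * ∫⁻ y, (E.Γ ^ n) y A ∂(E.Γ φ) := by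
            gcongr ?_ * _
            exact pow_le_pow_of_le_one zero_le prob_le_one (Nat.le_succ n)
        _ = ∫⁻ y, E.γ A ^ n * (E.Γ ^ n) y A ∂(E.Γ φ) :=
            (lintegral_const_mul _ (Kernel.measurable_coe _ hAm)).symm
        _ ≤ _ := lintegral_mono ih
    · rw [(lintegral_endoKernel φ p _).2 hφ]
      -- from a state in `A` on, it suffices that every entrant starts in `A`
      have hstay : ∀ n : ℕ, ∀ y ∈ A, E.γ A ^ n ≤ (E.endoKernel v p ^ n) y A := by
        intro n
        induction n with
        | zero =>
          intro y hy
          rw [kernel_pow_zero, Measure.dirac_apply' _ hAm, Set.indicator_of_mem hy]; simp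
        | succ n ih =>
          intro y hy
          rw [hpow, (lintegral_endoKernel y p _).2 hy]
          calc E.γ A ^ (n + 1) = ∫⁻ _ in A, E.γ A ^ n ∂E.γ := by
                rw [setLIntegral_const, pow_succ]
            _ ≤ ∫⁻ z in A, (E.endoKernel v p ^ n) z A ∂E.γ := setLIntegral_mono' hAm ih
            _ ≤ _ := setLIntegral_le_lintegral _ _
      calc E.γ A ^ (n + 1) * (E.Γ ^ (n + 1)) φ A ≤ E.γ A ^ (n + 1) * 1 := by
            gcongr; exact prob_le_one
        _ = ∫⁻ _ in A, E.γ A ^ n ∂E.γ := by rw [setLIntegral_const, pow_succ, mul_one]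
        _ ≤ ∫⁻ z in A, (E.endoKernel v p ^ n) z A ∂E.γ := setLIntegral_mono' hAm (hstay n)
        _ ≤ _ := setLIntegral_le_lintegral _ _

theorem IsValueFunction.isVUniformlyErgodic (hv : E.IsValueFunction δ v)
    (hE : E.Conditions δ) (hdrift : E.OutputDrift) {p : ℝ≥0} (hp : 0 < p) :
    IsVUniformlyErgodic (E.endoKernel v p) fun φ => 1 + E.q φ p := by
  classical
  have hq := hE.measurable_q p
  have hV : Measurable fun φ => ((1 + E.q φ p : ℝ≥0) : ℝ≥0∞) :=
    (measurable_const.add hq).coe_nnreal_ennreal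
  obtain ⟨-, lam, L, -, hlam, hL⟩ := hdrift p hp
  obtain ⟨a, ha, hthr⟩ := hv.exists_exitThreshold_eq hE hp
  have hcompl := compl_staySet hthr
  have hfinV := hv.lintegral_lifetimeMeasure_lt_top hE hdrift hp
  have := hv.isFiniteMeasure_lifetimeMeasure hE hdrift hp
  -- the invariant probability measure is the normalized occupation measure of a firm
  set c : ℝ≥0∞ := (E.lifetimeMeasure v p Set.univ)⁻¹ with hc
  have hmass : 1 ≤ E.lifetimeMeasure v p Set.univ := by
    have := occupation_apply_eq_add (κ := E.Γ) (hS := E.measurableSet_staySet v p) (γ := E.γ)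
      MeasurableSet.univ
    rw [lifetimeMeasure, this, measure_univ (μ := E.γ)]
    exact le_self_add
  have hc1 : c ≤ 1 := ENNReal.inv_le_one.2 hmass
  have hprob : IsProbabilityMeasure (c • E.lifetimeMeasure v p) := by
    refine ⟨?_⟩
    rw [Measure.smul_apply, smul_eq_mul, hc]
    exact ENNReal.inv_mul_cancel (zero_lt_one.trans_le hmass).ne' (measure_ne_top _ _)
  have hinv : (E.endoKernel v p).Invariant (c • E.lifetimeMeasure v p) :=
    invariant_occupation (measure_ne_top (E.lifetimeMeasure v p) Set.univ) c
  have hVμ : ∫⁻ φ, ((1 + E.q φ p : ℝ≥0) : ℝ≥0∞) ∂(c • E.lifetimeMeasure v p) < ∞ := by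
    rw [lintegral_smul_measure, smul_eq_mul]
    exact ENNReal.mul_lt_top (hc1.trans_lt ENNReal.one_lt_top) hfinV
  have hqμ : Integrable (fun φ => (E.q φ p : ℝ)) (c • E.lifetimeMeasure v p) := by
    refine (integrable_coe_of_lintegral_le hq (a := (∫⁻ φ, E.q φ p
      ∂(c • E.lifetimeMeasure v p)).toNNReal) ?_).1
    refine (ENNReal.coe_toNNReal (ne_top_of_le_ne_top hVμ.ne ?_)).ge
    exact lintegral_mono fun φ => by simp
  -- geometric drift of the endogenous process
  set Q : ℝ≥0 := (∫⁻ x, E.q x p ∂E.γ).toNNReal with hQ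
  have hQ' : ∫⁻ x, E.q x p ∂E.γ = Q := (ENNReal.coe_toNNReal (hE.lintegral_q_lt_top p).ne).symm
  have hdrift' : ∀ φ, ∫⁻ x, E.q x p ∂(E.endoKernel v p φ) ≤ lam * E.q φ p + (L + Q : ℝ≥0) := by
    intro φ
    by_cases hφ : φ ∈ E.staySet v p
    · rw [(lintegral_endoKernel φ p _).1 hφ]
      refine (hL φ).trans ?_
      gcongr
      exact le_self_add
    · rw [(lintegral_endoKernel φ p _).2 hφ, hQ', ENNReal.coe_add]
      exact le_add_left le_add_self
  -- minorization by a multiple of the distribution of entrants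
  have hγA : E.γ (E.staySet v p)ᶜ ≠ 0 := by
    rw [hcompl]
    refine ((hE.γ_pos (a / 2) (half_pos ha)).trans_le (measure_mono fun x hx => ?_)).ne'
    exact lt_of_le_of_lt hx (half_lt_self ha)
  have hminor : ∀ R : ℝ, ∃ (m : ℕ) (ν : Measure ℝ≥0), 0 < m ∧ IsFiniteMeasure ν ∧ ν ≠ 0 ∧
      ∀ x, (E.q x p : ℝ) ≤ R → ν ≤ (E.endoKernel v p ^ m) x := by
    intro R
    obtain ⟨n, ε, hε, hle⟩ := hE.exists_hitting_bound hdrift hp ha R.toNNReal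
    rw [← hcompl] at hle
    set η : ℝ≥0∞ := E.γ (E.staySet v p)ᶜ ^ n * ε with hη
    have hη0 : η ≠ 0 := mul_ne_zero (pow_ne_zero _ hγA) (by simpa using hε.ne')
    have hηtop : η ≠ ∞ := ENNReal.mul_ne_top (ENNReal.pow_ne_top (measure_ne_top _ _))
      ENNReal.coe_ne_top
    refine ⟨n + 1, η • E.γ, Nat.succ_pos n, E.γ.smul_finite hηtop, ?_, fun x hx => ?_⟩
    · intro h0
      have := congrArg (fun μ : Measure ℝ≥0 => μ Set.univ) h0
      simp [hη0] at this
    · have hx' : E.q x p ≤ R.toNNReal := NNReal.le_toNNReal_of_coe_le hx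
      refine Measure.le_iff.2 fun B hB => ?_
      rw [Kernel.pow_succ_apply_eq_lintegral _ _ _ hB, Measure.smul_apply, smul_eq_mul]
      have hA : MeasurableSet (E.staySet v p)ᶜ := (E.measurableSet_staySet v p).compl
      calc η * E.γ B ≤ (E.endoKernel v p ^ n) x (E.staySet v p)ᶜ * E.γ B := by
            gcongr
            refine le_trans ?_ (pow_endoKernel_compl_ge p n x)
            rw [hη]
            gcongr
            exact hle x hx'
        _ = ∫⁻ _ in (E.staySet v p)ᶜ, E.γ B ∂((E.endoKernel v p ^ n) x) := by
            rw [setLIntegral_const, mul_comm]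
        _ = ∫⁻ y in (E.staySet v p)ᶜ, E.endoKernel v p y B ∂((E.endoKernel v p ^ n) x) := by
            refine setLIntegral_congr_fun hA fun y hy => ?_
            simp only [endoKernel, Kernel.piecewise_apply, if_neg (show y ∉ E.staySet v p from hy),
              Kernel.const_apply]
        _ ≤ _ := setLIntegral_le_lintegral _ _
  refine ⟨measurable_const.add hq, fun φ => le_self_add, c • E.lifetimeMeasure v p, hprob, hinv,
    hVμ, fun n φ => ?_, ?_⟩
  · simp only [ENNReal.coe_add]
    rw [lintegral_add_left measurable_const]
    refine ENNReal.add_lt_top.2 ⟨by simp, ?_⟩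
    exact (lintegral_pow_le_of_drift _ hq hlam hdrift' n φ).trans_lt ENNReal.coe_lt_top
  · obtain ⟨C, ρ, hρ0, hρ1, h⟩ := harris_geometric (E.endoKernel v p) hq hlam hdrift' hminor
      (c • E.lifetimeMeasure v p) hinv hqμ
    refine ⟨C, ρ, hρ0, hρ1, fun n φ f hf hfV => ?_⟩
    have := h n φ f hf fun y => by simpa using hfV y
    simpa using this

/-! ### Stationary equilibrium -/

theorem Conditions.D_ne_top (hE : E.Conditions δ) {p : ℝ≥0} (hp : 0 < p) : E.D p ≠ ∞ :=
  (lt_top_of_lt (hE.D_strictAnti hp)).ne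

theorem Conditions.D_pos (hE : E.Conditions δ) (p : ℝ≥0) : 0 < E.D p :=
  zero_le.trans_lt (hE.D_strictAnti (lt_add_one p))

theorem Conditions.lifetimeOutput_ne_zero (hE : E.Conditions δ) {p : ℝ≥0} (hp : 0 < p) :
    E.lifetimeOutput v p ≠ 0 := by
  have hq := (hE.measurable_q p).coe_nnreal_ennreal
  rw [lifetimeOutput, lifetimeSum_eq_lintegral p hq, lifetimeMeasure,
    lintegral_occupation_eq_add _ _ hq]
  refine fun h0 => hE.γ_Ioi_ne_zero ?_
  have h1 := (lintegral_eq_zero_iff hq).1 (add_eq_zero.1 h0).1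
  refine measure_mono_null (fun x hx => ?_) (ae_iff.1 h1)
  have h2 : E.q 0 p < E.q x p := hE.q_strictMono_left p hp hx
  simpa using (zero_le.trans_lt h2).ne'

theorem IsValueFunction.lifetimeOutput_lt_top (hv : E.IsValueFunction δ v)
    (hE : E.Conditions δ) (hdrift : E.OutputDrift) {p : ℝ≥0} (hp : 0 < p) :
    E.lifetimeOutput v p < ∞ := by
  rw [lifetimeOutput, lifetimeSum_eq_lintegral p (hE.measurable_q p).coe_nnreal_ennreal]
  refine (lintegral_mono fun φ => ?_).trans_lt (hv.lintegral_lifetimeMeasure_lt_top hE hdrift hp)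
  simp

/-- Multiples of the occupation measure of a firm satisfy the flow conditions of a stationary
equilibrium, and clear the market if output equals demand. -/
theorem IsValueFunction.isEquilibrium_smul (hv : E.IsValueFunction δ v)
    (hE : E.Conditions δ) (hdrift : E.OutputDrift) {p : ℝ≥0} (hp : 0 < p)
    (hentry : ∫ x, v x p ∂E.γ = E.ce) {M : ℝ≥0} (hM : M * E.lifetimeOutput v p = E.D p) :
    E.IsEquilibrium v p (M • E.lifetimeMeasure v p) M := by
  have := hv.isFiniteMeasure_lifetimeMeasure hE hdrift hp
  have hS := E.measurableSet_staySet v p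
  refine ⟨hp, inferInstance, hentry.le, fun _ => hentry, fun B hB => ?_, ?_, ?_⟩
  · rw [Measure.restrict_smul, lintegral_smul_measure, Measure.smul_apply]
    rw [lifetimeMeasure, occupation_apply_eq_add hB, smul_add, add_comm]
    simp only [ENNReal.smul_def, smul_eq_mul]
  · have h1 : {φ : ℝ≥0 | (φ : ℝ≥0∞) < E.exitThreshold v p} = (E.staySet v p)ᶜ := by
      ext φ; simp [staySet]
    have h2 : E.lifetimeMeasure v p (E.staySet v p)ᶜ = 1 :=
      occupation_compl (measure_ne_top (E.lifetimeMeasure v p) Set.univ)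
    rw [h1, Measure.smul_apply, h2, ENNReal.smul_def, smul_eq_mul, mul_one]
  · rw [lintegral_smul_measure, ← hM, lifetimeOutput,
      lifetimeSum_eq_lintegral p (hE.measurable_q p).coe_nnreal_ennreal]
    rw [ENNReal.smul_def, smul_eq_mul]

/-- The measure of a stationary equilibrium is the mass of entrants times the occupation measure
of a firm. -/
theorem IsEquilibrium.eq_smul_lifetimeMeasure (hv : E.IsValueFunction δ v)
    (hE : E.Conditions δ) (hdrift : E.OutputDrift) {p : ℝ≥0} {μ : Measure ℝ≥0} {M : ℝ≥0}
    (h : E.IsEquilibrium v p μ M) : μ = M • E.lifetimeMeasure v p := by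
  have := h.finite
  have hS := E.measurableSet_staySet v p
  obtain ⟨B, hB⟩ := hv.exists_tsum_killedKernel_le hE hdrift h.price_pos
  refine eq_smul_occupation (M := (M : ℝ≥0∞)) (fun n x => ?_) (fun x => ?_) ?_
  · have := lintegral_killedKernel_pow_le (κ := E.Γ) (hS := hS) n x (f := 1) measurable_one
    simpa using this
  · refine ENNReal.tendsto_atTop_zero_of_tsum_ne_top
      (ne_top_of_le_ne_top ENNReal.coe_ne_top (le_trans ?_ (hB x)))
    refine ENNReal.tsum_le_tsum fun n => ?_
    rw [← lintegral_one]
    exact lintegral_mono fun y => by simp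
  · refine Measure.ext fun B hB => ?_
    rw [Measure.add_apply, Measure.bind_apply hB (Kernel.aemeasurable _), Measure.smul_apply,
      smul_eq_mul, h.invariant B hB]
    have h1 := lintegral_lintegral_killedKernel (κ := E.Γ) (hS := hS) μ (B.indicator 1)
    simp only [lintegral_indicator_one hB] at h1
    rw [h1]

end Industry

theorem proposition1 (E : Industry) (δ : ℝ) (hE : E.Conditions δ) (hdrift : E.OutputDrift) :
    ∃ v : ℝ≥0 → ℝ≥0 → ℝ,
      (E.IsValueFunction δ v ∧ ∀ w, E.IsValueFunction δ w → w = v) ∧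
      (∀ p, 0 < p → E.lifetimeOutput v p < ∞) ∧
      (∀ p, 0 < p → IsVUniformlyErgodic (E.endoKernel v p) fun φ => 1 + E.q φ p) ∧
      ∃ (pstar : ℝ≥0) (μstar : Measure ℝ≥0) (Mstar : ℝ≥0),
        (0 < pstar ∧ ∫ x, v x pstar ∂E.γ = E.ce ∧
          ∀ p, 0 < p → ∫ x, v x p ∂E.γ = E.ce → p = pstar) ∧
        E.IsEquilibrium v pstar μstar Mstar ∧
        (∀ p μ M, E.IsEquilibrium v p μ M → p = pstar ∧ μ = μstar ∧ M = Mstar) ∧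
        0 < Mstar ∧
        ∀ B, MeasurableSet B →
          μstar B = Mstar * E.lifetimeSum v pstar (B.indicator fun _ => 1) := by
  obtain ⟨v, hv⟩ := hE.exists_isValueFunction
  obtain ⟨p₀, hp₀, hentry⟩ := hv.exists_entry_eq hE
  have hinj := (hv.strictMono_entry hE).injective
  have hℓ0 := hE.lifetimeOutput_ne_zero (v := v) hp₀
  have hℓ := (hv.lifetimeOutput_lt_top hE hdrift hp₀).ne
  have hD0 := hE.D_pos p₀
  have hquot : E.D p₀ / E.lifetimeOutput v p₀ ≠ ∞ := ENNReal.div_ne_top (hE.D_ne_top hp₀) hℓ0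
  -- the mass of entrants equates lifetime output of all entrants to demand
  set M₀ : ℝ≥0 := (E.D p₀ / E.lifetimeOutput v p₀).toNNReal with hM₀
  have hM : M₀ * E.lifetimeOutput v p₀ = E.D p₀ := by
    rw [hM₀, ENNReal.coe_toNNReal hquot, ENNReal.div_mul_cancel hℓ0 hℓ]
  refine ⟨v, ⟨hv, fun w hw => hE.isValueFunction_unique hv hw⟩,
    fun p hp => hv.lifetimeOutput_lt_top hE hdrift hp,
    fun p hp => hv.isVUniformlyErgodic hE hdrift hp,
    p₀, M₀ • E.lifetimeMeasure v p₀, M₀,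
    ⟨hp₀, hentry, fun p _ h => hinj (h.trans hentry.symm)⟩,
    hv.isEquilibrium_smul hE hdrift hp₀ hentry hM, ?_, ?_, fun B hB => ?_⟩
  · intro p μ M h
    have hμ := h.eq_smul_lifetimeMeasure hv hE hdrift
    have hmarket : M * E.lifetimeOutput v p = E.D p := by
      have h1 := h.market
      rw [hμ, lintegral_smul_measure, ENNReal.smul_def, smul_eq_mul] at h1
      rwa [Industry.lifetimeOutput,
        Industry.lifetimeSum_eq_lintegral p (hE.measurable_q p).coe_nnreal_ennreal]
    have hMpos : 0 < M := by
      refine pos_iff_ne_zero.2 ?_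
      rintro rfl
      rw [ENNReal.coe_zero, zero_mul] at hmarket
      exact (hE.D_pos p).ne hmarket
    obtain rfl : p = p₀ := hinj ((h.entry_eq hMpos).trans hentry.symm)
    have hMM : M = M₀ := by
      have h2 : (M : ℝ≥0∞) = M₀ := by
        rwa [← hM, ENNReal.mul_left_inj hℓ0 hℓ] at hmarket
      exact_mod_cast h2
    exact ⟨rfl, by rw [hμ, hMM], hMM⟩
  · exact ENNReal.toNNReal_pos (ENNReal.div_pos hD0.ne' hℓ).ne' hquot
  · rw [Measure.smul_apply, Industry.lifetimeMeasure_apply p₀ hB, ENNReal.smul_def, smul_eq_mul]
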